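/- Let $\beta>0$. Label the vertices of rooted ordered trees by finite sequences of positive integers: the root is $\emptyset$, and the $j$th child (in order of birth) of $(x_1,\dots,x_k)$ is $(x_1,\dots,x_k,j)$. A tree is identified with its set of labels; $\deg(v,G)$ is the number of neighbours of $v$ in the tree $G$ ($0$ if $v\notin G$), and $\deg^+(v,G)$ is the number of its children. Let $(G_n)_{n\ge1}$ be the generalized PORT process with parameter $\beta$, that is, a sequence of random finite rooted ordered trees with $G_1=\{\emptyset\}$ such that for every $n\ge1$, given $G_1,\dots,G_n$, each vertex $v=(v_1,\dots,v_m)\in G_n$ is chosen with probability $$\frac{\deg^+(v,G_n)+\beta}{\sum_{u\in G_n}(\deg^+(u,G_n)+\beta)},$$ and then $G_{n+1}=G_n\cup\{(v_1,\dots,v_m,\deg^+(v,G_n)+1)\}$, i.e. the chosen vertex gets its next child. Then $\deg(\emptyset,G_n)/n^{1/(1+\beta)}$ converges almost surely to a nondegenerate (not almost surely constant) random variable $\zeta_0$. Moreover, let $k\ge1$ and let $x=(x_1,\dots,x_k)$ be a fixed sequence of positive integers. Then $$\frac{\deg(x,G_n)}{n^{1/(1+\beta)}}\to\zeta_x$$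 almost surely as $n\to\infty$, with some nondegenerate random variable $\zeta_x$. The distribution of $\zeta_x$ is that of a product $\tilde\zeta_0\,\xi_1\cdots\xi_k$, where $\tilde\zeta_0,\xi_1,\dots,\xi_k$ are independent random variables, $\tilde\zeta_0$ has the same distribution as $\zeta_0$, and $\xi_s$ has distribution $\mathrm{Beta}(\beta,x_s)$ for $1\le s\le k$. -/

import Mathlib

open MeasureTheory ProbabilityTheory Filter Topology

namespace FamilyTree

/-- The label of a vertex: a finite sequence of positive integers. The root is the empty sequence,
and the `j`-th child of `u` is `u ++ [j]`. -/
abbrev Label : Type := List ℕ+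

/-- `u` is the parent of `v`. -/
def IsParent (u v : Label) : Prop := ∃ j : ℕ+, v = u ++ [j]

/-- A finite set of labels is (the vertex set of) a rooted ordered tree if it contains the root and,
together with the `j`-th child of `u`, also `u` and all the earlier children of `u`. -/
def IsTree (T : Finset Label) : Prop :=
  [] ∈ T ∧ ∀ (u : Label) (j : ℕ+), u ++ [j] ∈ T → u ∈ T ∧ ∀ i : ℕ+, i ≤ j → u ++ [i] ∈ T

open Classical in
/-- The degree of the vertex `v` in the tree `T`: the number of its neighbours, that is, of its
children and its parent. It is `0` if `v` is not a vertex of `T`. -/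
noncomputable def degree (v : Label) (T : Finset Label) : ℕ :=
  (T.filter (fun u => v ∈ T ∧ (IsParent v u ∨ IsParent u v))).card

open Classical in
/-- The out-degree of the vertex `v` in the tree `T`: the number of its children. -/
noncomputable def outDegree (v : Label) (T : Finset Label) : ℕ :=
  (T.filter (fun u => IsParent v u)).card

/-- The weight of the vertex `v`: its out-degree plus `β`. -/
noncomputable def weight (β : ℝ) (v : Label) (T : Finset Label) : ℝ := outDegree v T + β

/-- The sum of the weights of all vertices. -/
noncomputable def totalWeight (β : ℝ) (T : Finset Label) : ℝ := ∑ v ∈ T, weight β v T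

/-- The tree obtained from `T` when the vertex `v` gives birth to its next child. -/
noncomputable def addChild (v : Label) (T : Finset Label) : Finset Label :=
  insert (v ++ [Nat.succPNat (outDegree v T)]) T

/-- The generalized plane oriented random tree (PORT) process `G 1, G 2, …` with parameter `β`,
as random variables on `(Ω, P)`. It starts from the tree that consists of the root only. Given
`G 1, …, G n`, the next vertex is attached to the vertex `v` of `G n` with probability proportional
to the out-degree of `v` plus `β`. The value `G 0` plays no role. -/
structure IsGeneralizedPORT {Ω : Type*} [MeasurableSpace Ω] (P : Measure Ω) (β : ℝ)
    (G : ℕ → Ω → Finset Label) : Prop where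
  measurableSet_eq : ∀ n : ℕ, 1 ≤ n → ∀ T : Finset Label, MeasurableSet {ω | G n ω = T}
  isTree : ∀ n : ℕ, 1 ≤ n → ∀ ω, IsTree (G n ω)
  initial : ∀ ω, G 1 ω = {[]}
  transition : ∀ n : ℕ, 1 ≤ n → ∀ t : ℕ → Finset Label, ∀ v ∈ t n,
    P.real {ω | (∀ i, 1 ≤ i → i ≤ n → G i ω = t i) ∧ G (n + 1) ω = addChild v (t n)} =
      weight β v (t n) / totalWeight β (t n) *
        P.real {ω | ∀ i, 1 ≤ i → i ≤ n → G i ω = t i}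

/-- The degree of the vertex `v` in `G n`, divided by `n ^ (1 / (1 + β))`, converges to `ζ`
almost surely. -/
def DegreeConverges {Ω : Type*} [MeasurableSpace Ω] (P : Measure Ω) (β : ℝ)
    (G : ℕ → Ω → Finset Label) (v : Label) (ζ : Ω → ℝ) : Prop :=
  ∀ᵐ ω ∂P, Tendsto (fun n : ℕ => (degree v (G n ω) : ℝ) / (n : ℝ) ^ (1 / (1 + β))) atTop
    (𝓝 (ζ ω))

/-- A real random variable is nondegenerate if it is not almost surely constant. -/
def Nondegenerate {Ω : Type*} [MeasurableSpace Ω] (P : Measure Ω) (ζ : Ω → ℝ) : Prop :=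
  ¬ ∃ c : ℝ, ∀ᵐ ω ∂P, ζ ω = c

end FamilyTree

/-!
The proof compares moments. Let `w n` be the total weight of the tree with `n + 1` vertices, which
is deterministic, and let `d` be the out-degree of a vertex `x`. While `x` is alive, its rising
factorials `(d + β) (d + β + 1) ⋯ (d + β + r - 1)` are multiplied by `1 + r / w n` in the mean,
given the past. Let `growth β r n` be the product of the first `n` of these factors.

* For `r = 1` this makes `(d + β) / growth β 1 n` a submartingale, which increases in the mean only
  through the birth of `x`. It is bounded in mean, hence converges almost surely. By Gauss's product
  for the Gamma function, `growth β 1 n` is asymptotic to `Γ(1 - 1 / (1 + β)) n ^ (1 / (1 + β))`. So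
  the scaled degree converges (`exists_degreeConverges`).
* For general `r`, the mean of the rising factorial, divided by `growth β r n`, is a constant times
  the mean of `1 / growth β r τ`, where `τ` is the time of birth of `x` (`integral_risingWeight`).
  For the `j`-th children of a fixed vertex, summation by parts in the recursion for the
  probabilities of birth shows that this mean changes by the factor `(β + j) / (β + j + r)` from the
  `j`-th child to the next one, the vertex itself counting as its child number `0`
  (`tendsto_discountedBirth`). The product of these factors over `0, …, j - 1` is the `r`-th moment
  of `Beta(β, j)` (`beta_add_div_beta`).
* Hence the moments of the limit at `x` are those of the limit at the root times the moments of
  independent beta variables. They are at most `C K ^ r r!`, so they determine the law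
  (`identDistrib_of_moments_eq`).
* The limit is nondegenerate since the second moment exceeds the square of the first. For the root
  this is a bound for the infinite product `∏ (1 - a ^ 2 / k ^ 2)` with `a = 1 / (1 + β)`
  (`lt_growthLimit_two`), and the beta factors only help.
-/

namespace FamilyTree

/-! ### Moments and laws -/

/-- A law with exponential moments is determined by its moments: they are the derivatives at `0` of
the complex moment generating function, which is analytic on a strip containing the imaginary axis,
and there it is the characteristic function. -/
theorem measure_eq_of_moments_eq {μ ν : Measure ℝ} [IsFiniteMeasure μ] [IsFiniteMeasure ν]
    (hμ : 0 ∈ interior (integrableExpSet id μ)) (hν : 0 ∈ interior (integrableExpSet id ν))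
    (h : ∀ n : ℕ, ∫ x, x ^ n ∂μ = ∫ x, x ^ n ∂ν) : μ = ν := by
  have aμ : AnalyticAt ℂ (complexMGF id μ) 0 := analyticAt_complexMGF (by simpa using hμ)
  have aν : AnalyticAt ℂ (complexMGF id ν) 0 := analyticAt_complexMGF (by simpa using hν)
  have hder (n : ℕ) :
      iteratedDeriv n (complexMGF id μ) 0 = iteratedDeriv n (complexMGF id ν) 0 := by
    rw [iteratedDeriv_complexMGF (by simpa using hμ), iteratedDeriv_complexMGF (by simpa using hν)]
    simpa [← Complex.ofReal_pow, integral_complex_ofReal] using h n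
  have hev : complexMGF id μ =ᶠ[𝓝 0] complexMGF id ν := by
    have h1 := aμ.hasFPowerSeriesAt
    have h2 := aν.hasFPowerSeriesAt
    simp only [hder] at h1
    have h3 := (h1.sub h2).locally_zero_iff.2 (sub_self _)
    filter_upwards [h3] with z hz using sub_eq_zero.1 hz
  have hU := AnalyticOnNhd.eqOn_of_preconnected_of_eventuallyEq (z₀ := (0 : ℂ))
    (U := {z : ℂ | z.re ∈ interior (integrableExpSet id μ) ∩ interior (integrableExpSet id ν)})
    (analyticOnNhd_complexMGF.mono fun z hz => hz.1)
    (analyticOnNhd_complexMGF.mono fun z hz => hz.2)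
    ((convex_integrableExpSet.interior.inter
      convex_integrableExpSet.interior).linear_preimage Complex.reLm).isPreconnected
    (by simp [hμ, hν]) hev
  refine Measure.ext_of_charFun (funext fun t => ?_)
  rw [← complexMGF_id_mul_I, ← complexMGF_id_mul_I]
  exact hU (by simp [hμ, hν])

/-- If the moments of `X ≥ 0` grow at most like those of an exponential distribution, then
`exp (t * X)` is integrable for all `t` close to `0`. -/
theorem zero_mem_interior_integrableExpSet_of_moments_le {Ω : Type*} [MeasurableSpace Ω]
    {μ : Measure Ω} [IsFiniteMeasure μ] {X : Ω → ℝ} (hX : AEMeasurable X μ) (hX0 : ∀ᵐ ω ∂μ, 0 ≤ X ω)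
    (hint : ∀ n : ℕ, Integrable (fun ω => X ω ^ n) μ) {C K : ℝ} (hC : 0 ≤ C) (hK : 0 < K)
    (hle : ∀ n : ℕ, ∫ ω, X ω ^ n ∂μ ≤ C * K ^ n * n.factorial) :
    0 ∈ interior (integrableExpSet X μ) := by
  have hpos : ∀ n : ℕ, ∀ᵐ ω ∂μ, 0 ≤ ((2 * K)⁻¹ * X ω) ^ n / n.factorial := fun n => by
    filter_upwards [hX0] with ω hω
    positivity
  have hterm (n : ℕ) : ∫⁻ ω, ENNReal.ofReal (((2 * K)⁻¹ * X ω) ^ n / n.factorial) ∂μ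
      ≤ ENNReal.ofReal (C * (1 / 2) ^ n) := by
    rw [← ofReal_integral_eq_lintegral_ofReal]
    · refine ENNReal.ofReal_le_ofReal ?_
      simp only [mul_pow, mul_div_right_comm]
      rw [integral_const_mul]
      calc (((2 * K)⁻¹ ^ n / n.factorial) * ∫ ω, X ω ^ n ∂μ)
          ≤ ((2 * K)⁻¹ ^ n / n.factorial) * (C * K ^ n * n.factorial) := by gcongr; exact hle n
        _ = C * (1 / 2) ^ n := by
          have := n.factorial_pos
          rw [show (2 * K)⁻¹ ^ n = (1 / 2) ^ n / K ^ n by rw [← div_pow]; congr 1; field_simp]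
          field_simp
    · simp only [mul_pow, mul_div_right_comm]
      exact (hint n).const_mul _
    · exact hpos n
  -- The choice `t = (2 * K)⁻¹` makes the exponential series a geometric series of ratio `1 / 2`.
  have hmem : (2 * K)⁻¹ ∈ integrableExpSet X μ := by
    refine ⟨by fun_prop, ?_⟩
    rw [hasFiniteIntegral_iff_ofReal (ae_of_all _ fun ω => (Real.exp_pos _).le)]
    have : ∀ᵐ ω ∂μ, ENNReal.ofReal (Real.exp ((2 * K)⁻¹ * X ω)) =
        ∑' n : ℕ, ENNReal.ofReal (((2 * K)⁻¹ * X ω) ^ n / n.factorial) := by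
      filter_upwards [hX0] with ω hω
      rw [Real.exp_eq_exp_ℝ, NormedSpace.exp_eq_tsum_div, ENNReal.ofReal_tsum_of_nonneg]
      · intro n; positivity
      · exact NormedSpace.expSeries_div_summable _
    rw [lintegral_congr_ae this, lintegral_tsum (by fun_prop)]
    calc _ ≤ ∑' n : ℕ, ENNReal.ofReal (C * (1 / 2) ^ n) := ENNReal.tsum_le_tsum hterm
      _ < ⊤ := by
        rw [← ENNReal.ofReal_tsum_of_nonneg (fun n => by positivity)
          (summable_geometric_two.mul_left C)]
        exact ENNReal.ofReal_lt_top
  have hneg : ∀ t ∈ Set.Iic (2 * K)⁻¹, t ∈ integrableExpSet X μ := fun t ht => by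
    refine Integrable.mono' hmem (by fun_prop) ?_
    filter_upwards [hX0] with ω hω
    rw [Real.norm_of_nonneg (Real.exp_pos _).le]
    exact Real.exp_le_exp.2 (mul_le_mul_of_nonneg_right ht hω)
  refine interior_mono hneg ?_
  rw [interior_Iic]
  exact Set.mem_Iio.2 (by positivity)

/-- Nonnegative random variables with the same moments have the same law if the moments grow at most
like those of an exponential distribution. -/
theorem identDistrib_of_moments_eq {Ω Ω' : Type*} [MeasurableSpace Ω] [MeasurableSpace Ω']
    {μ : Measure Ω} {ν : Measure Ω'} [IsFiniteMeasure μ] [IsFiniteMeasure ν]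
    {X : Ω → ℝ} {Y : Ω' → ℝ}
    (hX : Measurable X) (hY : Measurable Y) (hX0 : ∀ᵐ ω ∂μ, 0 ≤ X ω) (hY0 : ∀ᵐ ω ∂ν, 0 ≤ Y ω)
    (hXi : ∀ n : ℕ, Integrable (fun ω => X ω ^ n) μ)
    (hYi : ∀ n : ℕ, Integrable (fun ω => Y ω ^ n) ν)
    (heq : ∀ n : ℕ, ∫ ω, X ω ^ n ∂μ = ∫ ω, Y ω ^ n ∂ν) {C K : ℝ} (hC : 0 ≤ C) (hK : 0 < K)
    (hle : ∀ n : ℕ, ∫ ω, X ω ^ n ∂μ ≤ C * K ^ n * n.factorial) : IdentDistrib X Y μ ν := by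
  have hpow (n : ℕ) : Measurable fun x : ℝ => x ^ n := measurable_id.pow_const n
  have h0 : MeasurableSet {x : ℝ | 0 ≤ x} := measurableSet_Ici
  have hXn (n : ℕ) : ∫ x, x ^ n ∂(μ.map X) = ∫ ω, X ω ^ n ∂μ :=
    integral_map hX.aemeasurable (hpow n).aestronglyMeasurable
  have hYn (n : ℕ) : ∫ x, x ^ n ∂(ν.map Y) = ∫ ω, Y ω ^ n ∂ν :=
    integral_map hY.aemeasurable (hpow n).aestronglyMeasurable
  refine ⟨hX.aemeasurable, hY.aemeasurable, measure_eq_of_moments_eq ?_ ?_ fun n => ?_⟩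
  · refine zero_mem_interior_integrableExpSet_of_moments_le aemeasurable_id
      ((ae_map_iff hX.aemeasurable h0).2 hX0) (fun n => ?_) hC hK fun n => ?_
    · exact (integrable_map_measure (hpow n).aestronglyMeasurable hX.aemeasurable).2 (hXi n)
    · exact (hXn n).trans_le (hle n)
  · refine zero_mem_interior_integrableExpSet_of_moments_le aemeasurable_id
      ((ae_map_iff hY.aemeasurable h0).2 hY0) (fun n => ?_) hC hK fun n => ?_
    · exact (integrable_map_measure (hpow n).aestronglyMeasurable hY.aemeasurable).2 (hYi n)
    · exact ((hYn n).trans (heq n).symm).trans_le (hle n)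
  · rw [hXn, hYn, heq]

/-- Bounded second moments give uniform integrability, so that means converge to the mean of the
almost sure limit. -/
theorem integral_tendsto_of_ae_tendsto_of_sq_bounded {Ω : Type*} [MeasurableSpace Ω]
    {μ : Measure Ω} [IsFiniteMeasure μ] {f : ℕ → Ω → ℝ} {g : Ω → ℝ}
    (hf : ∀ n, Measurable (f n)) (hf0 : ∀ n, ∀ᵐ ω ∂μ, 0 ≤ f n ω)
    (hfi : ∀ n, Integrable (fun ω => f n ω ^ 2) μ) {C : ℝ} (hC : ∀ n, ∫ ω, f n ω ^ 2 ∂μ ≤ C)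
    (hfg : ∀ᵐ ω ∂μ, Tendsto (fun n => f n ω) atTop (𝓝 (g ω))) (hg : Measurable g) :
    Integrable g μ ∧ Tendsto (fun n => ∫ ω, f n ω ∂μ) atTop (𝓝 (∫ ω, g ω ∂μ)) := by
  have hL2 : ∀ n, MemLp (f n) 2 μ := fun n =>
    (memLp_two_iff_integrable_sq (hf n).aestronglyMeasurable).2 (hfi n)
  have hL1 : ∀ n, Integrable (f n) μ := fun n => (hL2 n).integrable (by norm_num)
  have hg0 : ∀ᵐ ω ∂μ, 0 ≤ g ω := by
    filter_upwards [hfg, ae_all_iff.2 hf0] with ω h1 h2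
    exact ge_of_tendsto' h1 h2
  have hC0 : 0 ≤ C := le_trans (integral_nonneg fun ω => sq_nonneg _) (hC 0)
  have hbd : ∀ n, ∫ ω, f n ω ∂μ ≤ C + μ.real Set.univ := fun n => by
    calc ∫ ω, f n ω ∂μ ≤ ∫ ω, (f n ω ^ 2 + 1) ∂μ :=
          integral_mono (hL1 n) ((hfi n).add (integrable_const _)) fun ω => by
            nlinarith [sq_nonneg (f n ω - 1)]
      _ = ∫ ω, f n ω ^ 2 ∂μ + μ.real Set.univ := by
          rw [integral_add (hfi n) (integrable_const _)]; simp
      _ ≤ _ := by linarith [hC n]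
  have hgi : Integrable g μ := by
    refine ⟨hg.aestronglyMeasurable, ?_⟩
    rw [hasFiniteIntegral_iff_ofReal hg0]
    have h1 : ∫⁻ ω, ENNReal.ofReal (g ω) ∂μ ≤
        liminf (fun n => ∫⁻ ω, ENNReal.ofReal (f n ω) ∂μ) atTop := by
      refine le_trans (lintegral_mono_ae ?_) (lintegral_liminf_le fun n => (hf n).ennreal_ofReal)
      filter_upwards [hfg] with ω hω
      exact ((ENNReal.continuous_ofReal.tendsto _).comp hω).liminf_eq.ge
    refine lt_of_le_of_lt (h1.trans ?_) (ENNReal.ofReal_lt_top (r := C + μ.real Set.univ))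
    refine liminf_le_of_le (by isBoundedDefault) fun b hb => ?_
    obtain ⟨n, hn⟩ := hb.exists
    refine hn.trans ?_
    rw [← ofReal_integral_eq_lintegral_ofReal (hL1 n) (hf0 n)]
    exact ENNReal.ofReal_le_ofReal (hbd n)
  refine ⟨hgi, ?_⟩
  -- Truncation at height `K` costs at most `C / K` in the mean, by `(y - K)⁺ ≤ y ^ 2 / K`.
  rw [Metric.tendsto_atTop]
  intro ε hε
  have htrunc : Tendsto (fun K : ℕ => ∫ ω, min (g ω) K ∂μ) atTop (𝓝 (∫ ω, g ω ∂μ)) := by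
    refine tendsto_integral_of_dominated_convergence (fun ω => |g ω|)
      (fun n => (hg.min measurable_const).aestronglyMeasurable) hgi.abs (fun n => ?_) ?_
    · filter_upwards [hg0] with ω h0
      rw [Real.norm_of_nonneg (le_min h0 (Nat.cast_nonneg _)), abs_of_nonneg h0]
      exact min_le_left _ _
    · refine ae_of_all _ fun ω => tendsto_const_nhds.congr' ?_
      filter_upwards [tendsto_natCast_atTop_atTop.eventually_ge_atTop (g ω)] with K hK
      rw [min_eq_left hK]
  have hsmall : ∀ᶠ K : ℕ in atTop, C / K < ε / 3 :=
    (tendsto_const_div_atTop_nhds_zero_nat C).eventually_lt_const (by positivity)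
  obtain ⟨K, hK1, hK2, hK3⟩ := ((Metric.tendsto_nhds.1 htrunc (ε / 3) (by positivity)).and
    (hsmall.and (eventually_gt_atTop 0))).exists
  have hK0 : (0 : ℝ) < K := by exact_mod_cast hK3
  have hconv : Tendsto (fun n => ∫ ω, min (f n ω) K ∂μ) atTop (𝓝 (∫ ω, min (g ω) K ∂μ)) := by
    refine tendsto_integral_of_dominated_convergence (fun _ => (K : ℝ))
      (fun n => ((hf n).min measurable_const).aestronglyMeasurable) (integrable_const _)
      (fun n => ?_) ?_
    · filter_upwards [hf0 n] with ω h0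
      rw [Real.norm_of_nonneg (le_min h0 hK0.le)]
      exact min_le_right _ _
    · filter_upwards [hfg] with ω hω using hω.min tendsto_const_nhds
  obtain ⟨N, hN⟩ := Metric.tendsto_atTop.1 hconv (ε / 3) (by positivity)
  refine ⟨N, fun n hn => ?_⟩
  have h1 := hN n hn
  have hmi : Integrable (fun ω => min (f n ω) (K : ℝ)) μ := (hL1 n).inf (integrable_const _)
  have h2 : ∫ ω, f n ω ∂μ - ∫ ω, min (f n ω) K ∂μ ≤ C / K := by
    rw [← integral_sub (hL1 n) hmi]
    calc _ ≤ ∫ ω, f n ω ^ 2 / K ∂μ := by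
          refine integral_mono ((hL1 n).sub hmi) ((hfi n).div_const _) fun ω => ?_
          dsimp only
          rw [le_div_iff₀ hK0]
          rcases le_total (f n ω) K with h | h
          · rw [min_eq_left h]; nlinarith [sq_nonneg (f n ω)]
          · rw [min_eq_right h]; nlinarith
      _ = (∫ ω, f n ω ^ 2 ∂μ) / K := integral_div _ _
      _ ≤ C / K := by gcongr; exact hC n
  have h3 : 0 ≤ ∫ ω, f n ω ∂μ - ∫ ω, min (f n ω) K ∂μ := by
    rw [← integral_sub (hL1 n) hmi]
    exact integral_nonneg fun ω => sub_nonneg.2 (min_le_left _ _)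
  rw [Real.dist_eq, abs_lt] at *
  constructor <;> linarith [hK1.1, hK1.2, h1.1, h1.2]

/-! ### Moments of the beta distribution -/

theorem integral_pow_betaMeasure {a b : ℝ} (ha : 0 < a) (hb : 0 < b) (r : ℕ) :
    Integrable (fun x => x ^ r) (betaMeasure a b) ∧
      ∫ x, x ^ r ∂(betaMeasure a b) = beta (a + r) b / beta a b := by
  have har : 0 < a + r := by positivity
  have hnn : ∀ {a : ℝ}, 0 < a → ∀ x, 0 ≤ betaPDFReal a b x := fun ha x => by
    by_cases h : 0 < x ∧ x < 1
    · exact (betaPDFReal_pos h.1 h.2 ha hb).le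
    · simp [betaPDFReal, h]
  have hint : ∀ {a : ℝ}, 0 < a → Integrable (betaPDFReal a b) := fun ha => by
    refine ⟨(measurable_betaPDFReal _ _).aestronglyMeasurable, ?_⟩
    rw [hasFiniteIntegral_iff_ofReal (ae_of_all _ (hnn ha))]
    exact (lintegral_betaPDF_eq_one ha hb).trans_lt ENNReal.one_lt_top
  have hone : ∫ x, betaPDFReal (a + r) b x = 1 := by
    rw [integral_eq_lintegral_of_nonneg_ae (ae_of_all _ (hnn har))
      (measurable_betaPDFReal _ _).aestronglyMeasurable]
    exact (congrArg ENNReal.toReal (lintegral_betaPDF_eq_one har hb)).trans ENNReal.toReal_one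
  have hmul : ∀ x, (betaPDF a b x).toReal • x ^ r =
      beta (a + r) b / beta a b * betaPDFReal (a + r) b x := fun x => by
    rw [betaPDF, ENNReal.toReal_ofReal (hnn ha x), smul_eq_mul]
    by_cases h : 0 < x ∧ x < 1
    · have h1 := (beta_pos ha hb).ne'
      have h2 := (beta_pos har hb).ne'
      rw [betaPDFReal, betaPDFReal, if_pos h, if_pos h,
        show a + r - 1 = a - 1 + r by ring, Real.rpow_add h.1, Real.rpow_natCast]
      field_simp
    · simp [betaPDFReal, h]
  have hm : Measurable (betaPDF a b) := (measurable_betaPDFReal a b).ennreal_ofReal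
  have hlt : ∀ᵐ x, betaPDF a b x < ⊤ := ae_of_all _ fun x => ENNReal.ofReal_lt_top
  constructor
  · rw [betaMeasure, integrable_withDensity_iff_integrable_smul' hm hlt]
    simp only [hmul]
    exact (hint har).const_mul _
  · rw [betaMeasure, integral_withDensity_eq_integral_toReal_smul hm hlt]
    simp only [hmul]
    rw [integral_const_mul, hone, mul_one]

theorem beta_add_div_beta {a : ℝ} (ha : 0 < a) (r : ℕ) {j : ℕ} (hj : 0 < j) :
    beta (a + r) j / beta a j = ∏ i ∈ Finset.range j, (a + i) / (a + i + r) := by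
  have hG : ∀ {b : ℝ}, 0 < b → ∀ j : ℕ, Real.Gamma (b + j) =
      Real.Gamma b * ∏ i ∈ Finset.range j, (b + i) := fun {b} hb j => by
    induction j with
    | zero => simp
    | succ j ih =>
      rw [Finset.prod_range_succ, ← mul_assoc, ← ih, Nat.cast_succ, ← add_assoc,
        Real.Gamma_add_one (by positivity), mul_comm]
  have hj' : (0 : ℝ) < j := by exact_mod_cast hj
  have har : 0 < a + r := by positivity
  have h1 := (Real.Gamma_pos_of_pos ha).ne'
  have h2 := (Real.Gamma_pos_of_pos har).ne'
  have h3 := (Real.Gamma_pos_of_pos hj').ne'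
  have h4 : ∏ i ∈ Finset.range j, (a + i) ≠ 0 := Finset.prod_ne_zero_iff.2 fun i _ => by positivity
  have h5 : ∏ i ∈ Finset.range j, (a + r + i) ≠ 0 :=
    Finset.prod_ne_zero_iff.2 fun i _ => by positivity
  rw [beta, beta, hG ha j, hG har j, Finset.prod_div_distrib]
  simp only [add_right_comm a _ (r : ℝ)]
  field_simp

theorem betaMeasure_ae_nonneg (a b : ℝ) : ∀ᵐ x ∂(betaMeasure a b), 0 ≤ x := by
  have hm : Measurable (betaPDF a b) := (measurable_betaPDFReal a b).ennreal_ofReal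
  rw [betaMeasure, ae_withDensity_iff hm]
  refine ae_of_all _ fun x hx => ?_
  by_contra h
  exact hx (betaPDF_eq_zero_of_nonpos (not_le.1 h).le)

section

/-! ### Combinatorics of ordered trees -/

/-- The `j`-th child of `v` for `j ≥ 1`, and `v` itself for `j = 0`. With this convention, `v` is a
vertex of out-degree exactly `j` in a tree that contains `child v j` but not `child v (j + 1)`. -/
def child (v : Label) : ℕ → Label
  | 0 => v
  | j + 1 => v ++ [j.succPNat]

theorem child_coe (v : Label) (j : ℕ+) : child v j = v ++ [j] := by
  obtain ⟨m, rfl⟩ : ∃ m : ℕ, j = m.succPNat := ⟨j.natPred, by simp⟩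
  rfl

variable {T : Finset Label}

/-- The labels of the children of a vertex form an initial segment, whose length is the out-degree.
-/
theorem child_mem_iff (hT : IsTree T) (v : Label) (j : ℕ) :
    child v j ∈ T ↔ v ∈ T ∧ j ≤ outDegree v T := by
  classical
  rcases j with _ | j
  · simp [child]
  have hinj : Function.Injective fun i : ℕ => v ++ [i.succPNat] := fun a b h => by
    simpa using h
  have hex : ∃ m : ℕ, v ++ [m.succPNat] ∉ T := by
    by_contra! h
    exact Set.infinite_of_injective_forall_mem hinj h T.finite_toSet
  let m := Nat.find hex
  have hm (i : ℕ) : v ++ [i.succPNat] ∈ T ↔ i < m := by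
    refine ⟨fun h => ?_, fun h => not_not.1 (Nat.find_min hex h)⟩
    by_contra! hle
    exact Nat.find_spec hex ((hT.2 v _ h).2 _ (Nat.succPNat_le_succPNat.2 hle))
  have hcard : outDegree v T = m := by
    have : T.filter (fun u => IsParent v u) =
        (Finset.range m).image fun i : ℕ => v ++ [i.succPNat] := by
      ext u
      simp only [Finset.mem_filter, Finset.mem_image, Finset.mem_range]
      constructor
      · rintro ⟨hu, j, rfl⟩
        obtain ⟨i, rfl⟩ : ∃ i : ℕ, j = i.succPNat := ⟨j.natPred, by simp⟩
        exact ⟨i, (hm i).1 hu, rfl⟩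
      · rintro ⟨i, hi, rfl⟩
        exact ⟨(hm i).2 hi, _, rfl⟩
    rw [outDegree]
    convert congrArg Finset.card this
    rw [Finset.card_image_of_injective _ hinj, Finset.card_range]
  rw [child, hm, hcard]
  refine ⟨fun h => ⟨(hT.2 v _ ((hm j).2 h)).1, h⟩, fun h => h.2⟩

theorem outDegree_eq_zero_of_notMem (hT : IsTree T) {v : Label} (hv : v ∉ T) :
    outDegree v T = 0 := by
  classical
  rw [outDegree, Finset.card_eq_zero, Finset.filter_eq_empty_iff]
  rintro u hu ⟨j, rfl⟩
  exact hv (hT.2 v j hu).1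

/-- The sum of the out-degrees is the number of edges, since every vertex but the root is the child
of exactly one vertex. -/
theorem totalWeight_eq (hT : IsTree T) (β : ℝ) : totalWeight β T = T.card * (1 + β) - 1 := by
  classical
  have hsum : ∑ v ∈ T, outDegree v T = (T.erase []).card := by
    have hmaps : ∀ u ∈ T.erase [], u.dropLast ∈ T := fun u hu => by
      obtain ⟨hne, hu⟩ := Finset.mem_erase.1 hu
      rw [← List.dropLast_append_getLast hne] at hu
      exact (hT.2 _ _ hu).1
    rw [Finset.card_eq_sum_card_fiberwise hmaps]
    refine Finset.sum_congr rfl fun v _ => ?_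
    rw [outDegree]
    congr 1
    ext u
    simp only [Finset.mem_filter, Finset.mem_erase]
    constructor
    · rintro ⟨hu, j, rfl⟩
      simp [hu]
    · rintro ⟨⟨hne, hu⟩, rfl⟩
      exact ⟨hu, u.getLast hne, (List.dropLast_append_getLast hne).symm⟩
  have hcard : ((T.erase []).card : ℝ) = T.card - 1 := by
    rw [Finset.card_erase_of_mem hT.1, Nat.cast_sub (Finset.card_pos.2 ⟨_, hT.1⟩), Nat.cast_one]
  simp only [totalWeight, weight, Finset.sum_add_distrib, Finset.sum_const, nsmul_eq_mul]
  rw [← Nat.cast_sum, hsum, hcard]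
  ring

theorem totalWeight_pos (hT : IsTree T) {β : ℝ} (hβ : 0 < β) : 0 < totalWeight β T := by
  rw [totalWeight_eq hT]
  have : (1 : ℝ) ≤ T.card := by exact_mod_cast Finset.card_pos.2 ⟨_, hT.1⟩
  nlinarith

theorem next_child_notMem (hT : IsTree T) (v : Label) :
    v ++ [Nat.succPNat (outDegree v T)] ∉ T := fun h =>
  absurd ((child_mem_iff hT v (outDegree v T + 1)).1 h).2 (by simp)

theorem card_addChild (hT : IsTree T) (v : Label) : (addChild v T).card = T.card + 1 := by
  rw [addChild, Finset.card_insert_of_notMem (next_child_notMem hT v)]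

theorem addChild_injective (hT : IsTree T) : Function.Injective fun v => addChild v T := by
  intro u v h
  have hu : u ++ [Nat.succPNat (outDegree u T)] ∈ addChild v T := by
    rw [← show addChild u T = addChild v T from h]
    exact Finset.mem_insert_self _ _
  rcases Finset.mem_insert.1 hu with h | h
  · exact (List.append_inj' h rfl).1
  · exact absurd h (next_child_notMem hT u)

theorem outDegree_addChild (hT : IsTree T) (x v : Label) :
    outDegree x (addChild v T) = outDegree x T + if x = v then 1 else 0 := by
  classical
  rw [outDegree, addChild, Finset.filter_insert]
  by_cases h : x = v
  · subst h
    rw [if_pos ⟨_, rfl⟩, if_pos rfl, Finset.card_insert_of_notMem fun hm =>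
      next_child_notMem hT x (Finset.mem_filter.1 hm).1]
    rfl
  · rw [if_neg, if_neg h]
    · rfl
    · rintro ⟨j, hj⟩
      exact h (List.append_inj' hj rfl).1.symm

theorem child_succ_mem_addChild_iff {v : Label} (y : Label) (j : ℕ) :
    child y (j + 1) ∈ addChild v T ↔ child y (j + 1) ∈ T ∨ (y = v ∧ outDegree y T = j) := by
  rw [addChild, Finset.mem_insert, or_comm]
  refine or_congr_right ⟨fun h => ?_, ?_⟩
  · obtain ⟨rfl, h2⟩ := List.append_inj' h rfl
    refine ⟨rfl, ?_⟩
    have h3 : j.succPNat = (outDegree y T).succPNat := by simpa using h2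
    exact (Nat.succPNat_injective h3).symm
  · rintro ⟨rfl, rfl⟩
    rfl

/-- The degree counts, besides the children, at most the parent. It is `0` outside the tree, where
the out-degree vanishes as well. -/
theorem outDegree_le_degree (hT : IsTree T) (v : Label) : outDegree v T ≤ degree v T := by
  by_cases hv : v ∈ T
  · refine Finset.card_le_card fun u hu => ?_
    simp only [Finset.mem_filter] at hu ⊢
    exact ⟨hu.1, hv, Or.inl hu.2⟩
  · simp [outDegree_eq_zero_of_notMem hT hv]

theorem degree_le_outDegree_add_one (v : Label) : degree v T ≤ outDegree v T + 1 := by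
  classical
  have h1 : (T.filter fun u => IsParent u v).card ≤ 1 := by
    rw [Finset.card_le_one]
    intro a ha b hb
    obtain ⟨i, hi⟩ := (Finset.mem_filter.1 ha).2
    obtain ⟨j, hj⟩ := (Finset.mem_filter.1 hb).2
    exact (List.append_inj' (hi.symm.trans hj) rfl).1
  refine le_trans (Finset.card_le_card (t := T.filter (fun u => IsParent v u) ∪
    T.filter fun u => IsParent u v) fun u hu => ?_) ((Finset.card_union_le _ _).trans ?_)
  · simp only [Finset.mem_filter, Finset.mem_union] at hu ⊢
    tauto
  · refine add_le_add (le_of_eq ?_) h1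
    rw [outDegree]

open Classical in
/-- The number `(d + β) (d + β + 1) ⋯ (d + β + r - 1)`, where `d` is the out-degree of `x` in `T`;
it is `0` if `x` is not a vertex of `T`. For `r = 0` it is the indicator of `x ∈ T`, and for `r = 1`
the weight of `x`. -/
noncomputable def risingWeight (β : ℝ) (r : ℕ) (x : Label) (T : Finset Label) : ℝ :=
  if x ∈ T then (ascPochhammer ℝ r).eval (outDegree x T + β) else 0

/-- The reason why rising factorials are the right test functions: a jump `y → y + 1` at rate `y`
multiplies them by a constant in the mean. -/
theorem ascPochhammer_eval_add_one_mul (r : ℕ) (y : ℝ) :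
    ((ascPochhammer ℝ r).eval (y + 1) - (ascPochhammer ℝ r).eval y) * y =
      r * (ascPochhammer ℝ r).eval y := by
  have h1 := ascPochhammer_succ_eval r y
  have h2 : (ascPochhammer ℝ (r + 1)).eval y = y * (ascPochhammer ℝ r).eval (y + 1) := by
    rw [ascPochhammer_succ_left]; simp
  linear_combination h1 - h2

theorem risingWeight_zero (β : ℝ) (x : Label) [Decidable (x ∈ T)] :
    risingWeight β 0 x T = if x ∈ T then 1 else 0 := by
  simp [risingWeight]

theorem risingWeight_nonneg {β : ℝ} (hβ : 0 < β) (r : ℕ) (x : Label) (T : Finset Label) :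
    0 ≤ risingWeight β r x T := by
  rw [risingWeight]
  split_ifs
  · exact (ascPochhammer_pos _ _ (by positivity)).le
  · exact le_rfl

open Classical in
/-- The change of `risingWeight` in one step: either `x` is the vertex that reproduces,
or `x` is born. -/
theorem risingWeight_addChild (hT : IsTree T) (β : ℝ) (r : ℕ) (x : Label) {v : Label} (hv : v ∈ T) :
    risingWeight β r x (addChild v T) = risingWeight β r x T +
      (if x = v then (ascPochhammer ℝ r).eval (outDegree x T + β + 1) -
        (ascPochhammer ℝ r).eval (outDegree x T + β) else 0) +
      (ascPochhammer ℝ r).eval β * (risingWeight β 0 x (addChild v T) - risingWeight β 0 x T) := by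
  simp only [risingWeight, outDegree_addChild hT]
  by_cases hx : x ∈ T
  · have hx' : x ∈ addChild v T := Finset.mem_insert_of_mem hx
    by_cases h : x = v
    · rw [if_pos h, if_pos hx, if_pos hx', if_pos h]
      simp [hx, hx', add_right_comm]
    · simp [hx, hx', h]
  · have h : x ≠ v := fun h => hx (h ▸ hv)
    by_cases hx' : x ∈ addChild v T
    · simp [hx, hx', h, outDegree_eq_zero_of_notMem hT hx]
    · simp [hx, hx', h]

end

section

/-! ### The PORT process and its history -/

/-- The first `n + 1` trees `G 1, …, G (n + 1)` of the process. -/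
def history {Ω : Type*} (G : ℕ → Ω → Finset Label) (n : ℕ) (ω : Ω) : Fin (n + 1) → Finset Label :=
  fun i => G (i + 1) ω

/-- The event that `v` is the vertex of `G (n + 1)` that reproduces. -/
def chosen {Ω : Type*} (G : ℕ → Ω → Finset Label) (v : Label) (n : ℕ) : Set Ω :=
  {ω | v ∈ G (n + 1) ω ∧ G (n + 2) ω = addChild v (G (n + 1) ω)}

/-- The total weight of a tree with `n + 1` vertices. -/
noncomputable def stepWeight (β : ℝ) (n : ℕ) : ℝ := (n + 1) * (1 + β) - 1

variable {Ω : Type*} [MeasurableSpace Ω] {P : Measure Ω} {β : ℝ} {G : ℕ → Ω → Finset Label}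

namespace IsGeneralizedPORT

theorem measurable_history (hG : IsGeneralizedPORT P β G) (n : ℕ) :
    @Measurable _ _ _ ⊤ (history G n) := by
  let _ : MeasurableSpace (Fin (n + 1) → Finset Label) := ⊤
  refine measurable_to_countable' fun a => ?_
  have : history G n ⁻¹' {a} = ⋂ i : Fin (n + 1), {ω | G (i + 1) ω = a i} := by
    ext ω
    simp [history, funext_iff]
  rw [this]
  exact MeasurableSet.iInter fun i => hG.measurableSet_eq _ (by omega) _

/-- The filtration generated by the process; its index `n` corresponds to the tree `G (n + 1)`. -/
def filtration (hG : IsGeneralizedPORT P β G) : Filtration ℕ ‹MeasurableSpace Ω› where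
  seq n := MeasurableSpace.comap (history G n) ⊤
  mono' := monotone_nat_of_le_succ fun n => by
    have : history G n = (fun a i => a i.castSucc) ∘ history G (n + 1) := rfl
    rw [this, ← MeasurableSpace.comap_comp]
    exact MeasurableSpace.comap_mono le_top
  le' n := (hG.measurable_history n).comap_le

theorem measurable_filtration (hG : IsGeneralizedPORT P β G) {E : Type*} [MeasurableSpace E]
    (φ : Finset Label → E) (n : ℕ) : Measurable[hG.filtration n] fun ω => φ (G (n + 1) ω) := by
  let _ : MeasurableSpace (Fin (n + 1) → Finset Label) := ⊤
  exact (measurable_from_top (f := fun a : Fin (n + 1) → Finset Label => φ (a (Fin.last n)))).comp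
    (comap_measurable (history G n))

theorem measurable_comp (hG : IsGeneralizedPORT P β G) {E : Type*} [MeasurableSpace E]
    (φ : Finset Label → E) (n : ℕ) : Measurable fun ω => φ (G (n + 1) ω) :=
  (hG.measurable_filtration φ n).mono (hG.filtration.le n) le_rfl

theorem measurableSet_chosen (hG : IsGeneralizedPORT P β G) (v : Label) (n : ℕ) :
    MeasurableSet (chosen G v n) := by
  let _ : MeasurableSpace (Fin (n + 2) → Finset Label) := ⊤
  exact hG.measurable_history (n + 1) (t := {a | v ∈ a ⟨n, by omega⟩ ∧
    a (Fin.last _) = addChild v (a ⟨n, by omega⟩)}) trivial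

/-- The transition probability, in terms of the history up to time `n + 1`. -/
theorem measureReal_history_inter_chosen (hG : IsGeneralizedPORT P β G) {n : ℕ}
    (a : Fin (n + 1) → Finset Label) {v : Label} (hv : v ∈ a (Fin.last n)) :
    P.real (history G n ⁻¹' {a} ∩ chosen G v n) =
      weight β v (a (Fin.last n)) / totalWeight β (a (Fin.last n)) *
        P.real (history G n ⁻¹' {a}) := by
  let t : ℕ → Finset Label := fun i => if h : i - 1 < n + 1 then a ⟨i - 1, h⟩ else ∅
  have ht : t (n + 1) = a (Fin.last n) := by simp [t, Fin.last]
  have hA (ω : Ω) : (∀ i, 1 ≤ i → i ≤ n + 1 → G i ω = t i) ↔ history G n ω = a := by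
    refine ⟨fun h => funext fun i => ?_, fun h i h1 h2 => ?_⟩
    · rw [history, h _ (by omega) (by omega)]
      exact dif_pos (show (i : ℕ) + 1 - 1 < n + 1 by omega)
    · obtain ⟨i, rfl⟩ : ∃ m, i = m + 1 := ⟨i - 1, by omega⟩
      simp only [t, Nat.add_sub_cancel, ← h, history]
      rw [dif_pos (by omega)]
  have key := hG.transition (n + 1) (by omega) t v (ht ▸ hv)
  simp only [hA, ht] at key
  rw [show history G n ⁻¹' {a} = {ω | history G n ω = a} from rfl, ← key]
  congr 1
  ext ω
  simp only [chosen, Set.mem_inter_iff, Set.mem_ofPred_eq]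
  refine and_congr_right fun h => ?_
  have : G (n + 1) ω = a (Fin.last n) := congrFun h (Fin.last n)
  simp [this, hv]

/-- Almost surely, every tree arises from the preceding one by a birth: the transition probabilities
from a given history add up to one. -/
theorem ae_exists_mem_chosen [IsProbabilityMeasure P] (hβ : 0 < β) (hG : IsGeneralizedPORT P β G) :
    ∀ᵐ ω ∂P, ∀ n, ∃ v, ω ∈ chosen G v n := by
  rw [ae_all_iff]
  intro n
  have key (a : Fin (n + 1) → Finset Label) :
      P {ω | history G n ω = a ∧ ¬ ∃ v, ω ∈ chosen G v n} = 0 := by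
    by_cases hT : IsTree (a (Fin.last n))
    swap
    · convert measure_empty (μ := P)
      ext ω
      simp only [Set.mem_ofPred_eq, Set.mem_empty_iff_false, iff_false]
      rintro ⟨rfl, -⟩
      exact hT (hG.isTree _ (by simp) ω)
    set T := a (Fin.last n)
    have hmA : MeasurableSet (history G n ⁻¹' {a}) := hG.measurable_history n trivial
    have hm (v : Label) : MeasurableSet (history G n ⁻¹' {a} ∩ chosen G v n) :=
      hmA.inter (hG.measurableSet_chosen v n)
    have hT' {ω : Ω} (h : history G n ω = a) : G (n + 1) ω = T := congrFun h (Fin.last n)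
    have hsum : P.real (⋃ v ∈ T, history G n ⁻¹' {a} ∩ chosen G v n) =
        P.real (history G n ⁻¹' {a}) := by
      rw [measureReal_biUnion_finset _ fun v _ => hm v]
      · rw [Finset.sum_congr rfl fun v hv => hG.measureReal_history_inter_chosen a hv,
          ← Finset.sum_mul, ← Finset.sum_div]
        change totalWeight β T / totalWeight β T * _ = _
        rw [div_self (totalWeight_pos hT hβ).ne', one_mul]
      · intro u _ v _ huv
        refine Set.disjoint_left.2 fun ω h1 h2 => huv ?_
        have e := h1.2.2.symm.trans h2.2.2
        rw [hT' h1.1] at e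
        exact addChild_injective hT e
    have hsub : (⋃ v ∈ T, history G n ⁻¹' {a} ∩ chosen G v n) ⊆ history G n ⁻¹' {a} :=
      Set.iUnion₂_subset fun v _ => Set.inter_subset_left
    have hdiff :
        P.real (history G n ⁻¹' {a} \ ⋃ v ∈ T, history G n ⁻¹' {a} ∩ chosen G v n) = 0 := by
      rw [measureReal_sdiff hsub (Finset.measurableSet_biUnion _ fun v _ => hm v), hsum, sub_self]
    refine measure_mono_null ?_ ((measureReal_eq_zero_iff).1 hdiff)
    rintro ω ⟨h1, h2⟩
    refine ⟨h1, fun h => h2 ?_⟩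
    obtain ⟨v, -, h⟩ := Set.mem_iUnion₂.1 h
    exact ⟨v, h.2⟩
  rw [ae_iff]
  refine measure_mono_null (fun ω hω => ?_) (measure_iUnion_null key)
  exact Set.mem_iUnion.2 ⟨history G n ω, rfl, hω⟩

theorem ae_card_eq [IsProbabilityMeasure P] (hβ : 0 < β) (hG : IsGeneralizedPORT P β G) :
    ∀ᵐ ω ∂P, ∀ n, (G (n + 1) ω).card = n + 1 := by
  filter_upwards [hG.ae_exists_mem_chosen hβ] with ω hω n
  induction n with
  | zero => rw [zero_add, hG.initial, Finset.card_singleton]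
  | succ n ih =>
    obtain ⟨v, hv⟩ := hω n
    rw [hv.2, card_addChild (hG.isTree _ (by omega) ω), ih]

open Classical in
/-- At any time, almost surely only finitely many trees are possible. -/
theorem exists_finset_ae_mem [IsProbabilityMeasure P] (hβ : 0 < β) (hG : IsGeneralizedPORT P β G)
    (n : ℕ) : ∃ S : Finset (Finset Label), ∀ᵐ ω ∂P, G (n + 1) ω ∈ S := by
  induction n with
  | zero => exact ⟨{{[]}}, ae_of_all _ fun ω => by simp [hG.initial]⟩
  | succ n ih =>
    obtain ⟨S, hS⟩ := ih
    refine ⟨S.biUnion fun T => T.image fun v => addChild v T, ?_⟩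
    filter_upwards [hS, hG.ae_exists_mem_chosen hβ] with ω h1 h2
    obtain ⟨v, hv⟩ := h2 n
    exact Finset.mem_biUnion.2 ⟨_, h1, Finset.mem_image.2 ⟨v, hv.1, hv.2.symm⟩⟩

theorem integrable_comp [IsProbabilityMeasure P] (hβ : 0 < β) (hG : IsGeneralizedPORT P β G)
    (φ : Finset Label → ℝ) (n : ℕ) : Integrable (fun ω => φ (G (n + 1) ω)) P := by
  obtain ⟨S, hS⟩ := hG.exists_finset_ae_mem hβ n
  refine Integrable.mono' (integrable_const (∑ T ∈ S, |φ T|))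
    (hG.measurable_comp φ n).aestronglyMeasurable ?_
  filter_upwards [hS] with ω hω
  exact Finset.single_le_sum (f := fun T => |φ T|) (fun _ _ => abs_nonneg _) hω

/-- Given the past, the vertex `v` reproduces with probability proportional to its weight. -/
theorem setIntegral_indicator_chosen [IsProbabilityMeasure P] (hβ : 0 < β)
    (hG : IsGeneralizedPORT P β G) (φ : Finset Label → ℝ) (v : Label) (n : ℕ) {s : Set Ω}
    (hs : MeasurableSet[hG.filtration n] s) :
    ∫ ω in s, (chosen G v n).indicator (fun ω => φ (G (n + 1) ω)) ω ∂P =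
      ∫ ω in s, φ (G (n + 1) ω) * risingWeight β 1 v (G (n + 1) ω) / stepWeight β n ∂P := by
  have htot : ∀ᵐ ω ∂P, totalWeight β (G (n + 1) ω) = stepWeight β n := by
    filter_upwards [hG.ae_card_eq hβ] with ω hω
    rw [totalWeight_eq (hG.isTree _ (by omega) ω), hω, stepWeight, Nat.cast_succ]
  have hrhs : ∫ ω in s, φ (G (n + 1) ω) * risingWeight β 1 v (G (n + 1) ω) / stepWeight β n ∂P =
      ∫ ω in s, φ (G (n + 1) ω) * risingWeight β 1 v (G (n + 1) ω) /
        totalWeight β (G (n + 1) ω) ∂P := by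
    refine integral_congr_ae (ae_restrict_of_ae ?_)
    filter_upwards [htot] with ω hω
    rw [hω]
  rw [hrhs]
  obtain ⟨A, -, rfl⟩ := hs
  -- An event of the past is a countable disjoint union of single histories.
  have hunion : history G n ⁻¹' A = ⋃ a : A, history G n ⁻¹' {a.1} := by
    ext ω
    simp
  have hmeas (a : Fin (n + 1) → Finset Label) : MeasurableSet (history G n ⁻¹' {a}) :=
    hG.measurable_history n trivial
  have hdisj : Pairwise (Function.onFun Disjoint fun a : A => history G n ⁻¹' {a.1}) :=
    fun a b hab => Set.disjoint_left.2 fun ω h1 h2 => hab (Subtype.ext (h1.symm.trans h2))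
  rw [hunion, integral_iUnion (fun a : A => hmeas a.1) hdisj
      ((hG.integrable_comp hβ φ n).indicator (hG.measurableSet_chosen v n)).integrableOn,
    integral_iUnion (fun a : A => hmeas a.1) hdisj (hG.integrable_comp hβ
      (fun T => φ T * risingWeight β 1 v T / totalWeight β T) n).integrableOn]
  refine tsum_congr fun ⟨a, _⟩ => ?_
  dsimp only
  have hT {ω : Ω} (h : ω ∈ history G n ⁻¹' {a}) : G (n + 1) ω = a (Fin.last n) :=
    congrFun h (Fin.last n)
  rw [setIntegral_indicator (hG.measurableSet_chosen v n),
    setIntegral_congr_fun (g := fun _ => φ (a (Fin.last n)))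
      ((hmeas a).inter (hG.measurableSet_chosen v n)) fun ω h => by simp only [hT h.1],
    setIntegral_congr_fun (g := fun _ => φ (a (Fin.last n)) *
      risingWeight β 1 v (a (Fin.last n)) / totalWeight β (a (Fin.last n))) (hmeas a)
      fun ω h => by simp only [hT h],
    setIntegral_const, setIntegral_const, smul_eq_mul, smul_eq_mul]
  by_cases hv : v ∈ a (Fin.last n)
  · rw [hG.measureReal_history_inter_chosen a hv]
    simp [risingWeight, hv, weight]
    ring
  · have : history G n ⁻¹' {a} ∩ chosen G v n = ∅ := by
      refine Set.eq_empty_of_forall_notMem fun ω h => hv ?_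
      rw [← hT h.1]
      exact h.2.1
    simp [this, risingWeight, hv]

end IsGeneralizedPORT

end

section

/-! ### Growth rates -/

/-- The product of the factors `1 + r / w`, where `w` runs over the total weights of the first `n`
trees. It is the factor by which rising factorials of order `r` grow in the mean. -/
noncomputable def growth (β : ℝ) (r n : ℕ) : ℝ := ∏ k ∈ Finset.range n, (1 + r / stepWeight β k)

variable {β : ℝ}

theorem stepWeight_pos (hβ : 0 < β) (n : ℕ) : 0 < stepWeight β n := by
  rw [stepWeight]
  have : (0 : ℝ) ≤ n := n.cast_nonneg
  nlinarith

theorem growth_succ (β : ℝ) (r n : ℕ) :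
    growth β r (n + 1) = growth β r n * (1 + r / stepWeight β n) :=
  Finset.prod_range_succ _ _

theorem one_le_growth_factor (hβ : 0 < β) (r n : ℕ) : 1 ≤ 1 + r / stepWeight β n :=
  le_add_of_nonneg_right (div_nonneg r.cast_nonneg (stepWeight_pos hβ n).le)

theorem growth_pos (hβ : 0 < β) (r n : ℕ) : 0 < growth β r n :=
  Finset.prod_pos fun k _ => zero_lt_one.trans_le (one_le_growth_factor hβ r k)

/-- The mean growth of order `r`, relative to the `r`-th power of the mean growth of order `1`. -/
noncomputable def growthRatio (β : ℝ) (r n : ℕ) : ℝ := growth β r n / growth β 1 n ^ r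

theorem growthRatio_eq_prod (β : ℝ) (r n : ℕ) : growthRatio β r n =
    ∏ k ∈ Finset.range n, (1 + r / stepWeight β k) / (1 + 1 / stepWeight β k) ^ r := by
  rw [growthRatio, growth, growth, Finset.prod_div_distrib, Finset.prod_pow, Nat.cast_one]

theorem growthRatio_nonneg (hβ : 0 < β) (r n : ℕ) : 0 ≤ growthRatio β r n :=
  div_nonneg (growth_pos hβ r n).le (pow_nonneg (growth_pos hβ 1 n).le _)

theorem growthRatio_antitone (hβ : 0 < β) (r : ℕ) : Antitone (growthRatio β r) := by
  refine antitone_nat_of_succ_le fun n => ?_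
  have hw := stepWeight_pos hβ n
  rw [growthRatio_eq_prod, Finset.prod_range_succ, ← growthRatio_eq_prod]
  refine mul_le_of_le_one_right (growthRatio_nonneg hβ r n) ?_
  rw [div_le_one (by positivity)]
  have := one_add_mul_le_pow (a := 1 / stepWeight β n) (by
    have : 0 < 1 / stepWeight β n := by positivity
    linarith) r
  rwa [mul_one_div] at this

theorem growthRatio_le_one (hβ : 0 < β) (r n : ℕ) : growthRatio β r n ≤ 1 := by
  simpa [growthRatio, growth] using growthRatio_antitone hβ r n.zero_le

/-- The limit of `growthRatio`, as the infimum of an antitone sequence. -/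
noncomputable def growthLimit (β : ℝ) (r : ℕ) : ℝ := ⨅ n, growthRatio β r n

theorem tendsto_growthRatio (hβ : 0 < β) (r : ℕ) :
    Tendsto (growthRatio β r) atTop (𝓝 (growthLimit β r)) :=
  tendsto_atTop_ciInf (growthRatio_antitone hβ r)
    ⟨0, Set.forall_mem_range.2 (growthRatio_nonneg hβ r)⟩

theorem growthLimit_le_one (hβ : 0 < β) (r : ℕ) : growthLimit β r ≤ 1 :=
  le_of_tendsto' (tendsto_growthRatio hβ r) (growthRatio_le_one hβ r)

theorem growthLimit_one (hβ : 0 < β) : growthLimit β 1 = 1 := by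
  have (n : ℕ) : growthRatio β 1 n = 1 := by
    rw [growthRatio, pow_one, div_self (growth_pos hβ 1 n).ne']
  simp [growthLimit, this]

/-- The inequality behind the nondegeneracy of the limits. With `a = (1 + β)⁻¹`, the left-hand side
is `1 - a` and the right-hand side is `∏ (1 - a ^ 2 / k ^ 2)` over `k ≥ 1`; from `k = 2` on, the
factors dominate the telescoping quotients of `1 + a / k`, strictly so for `k = 2`. -/
theorem lt_growthLimit_two (hβ : 0 < β) : β / (1 + β) < growthLimit β 2 := by
  set a := (1 + β)⁻¹ with ha
  have ha0 : 0 < a := by positivity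
  have ha1 : a < 1 := inv_lt_one_of_one_lt₀ (by linarith)
  have hfac (k : ℕ) : (1 + (2 : ℕ) / stepWeight β k) / (1 + 1 / stepWeight β k) ^ 2 =
      1 - a ^ 2 / (k + 1) ^ 2 := by
    have hw := stepWeight_pos hβ k
    have hβ' : 0 < 1 + β := by linarith
    have h1 : stepWeight β k + 1 = (k + 1) * (1 + β) := by rw [stepWeight]; ring
    have h2 : 1 - a ^ 2 / (k + 1) ^ 2 = 1 - 1 / (stepWeight β k + 1) ^ 2 := by
      rw [h1, ha]; field_simp
    rw [h2]
    push_cast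
    field_simp
    ring
  have hbound (n : ℕ) : (1 - a) * (1 + a / (n + 2)) * ((1 - a ^ 2 / 4) * (1 + a) / (1 + a / 2)) ≤
      growthRatio β 2 (n + 2) := by
    induction n with
    | zero =>
      rw [growthRatio_eq_prod, Finset.prod_range_succ, Finset.prod_range_one, hfac, hfac]
      have : 1 + a / 2 ≠ 0 := by positivity
      simp only [Nat.cast_zero, Nat.cast_one]
      refine le_of_eq ?_
      field_simp
      ring
    | succ n ih =>
      rw [growthRatio_eq_prod, Finset.prod_range_succ, ← growthRatio_eq_prod, hfac]
      have hf : 0 ≤ 1 - a ^ 2 / ((n + 2 : ℕ) + 1 : ℝ) ^ 2 := by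
        rw [sub_nonneg, div_le_one (by positivity)]
        have : (0 : ℝ) ≤ (n + 2 : ℕ) := Nat.cast_nonneg _
        nlinarith
      refine le_trans ?_ (mul_le_mul_of_nonneg_right ih hf)
      have hc : 0 ≤ (1 - a) * ((1 - a ^ 2 / 4) * (1 + a) / (1 + a / 2)) := by
        have : 0 ≤ 1 - a ^ 2 / 4 := by nlinarith
        have : 0 ≤ 1 - a := by linarith
        positivity
      have hstep : 1 + a / ((n + 1 : ℕ) + 2 : ℝ) ≤
          (1 + a / (n + 2)) * (1 - a ^ 2 / ((n + 2 : ℕ) + 1 : ℝ) ^ 2) := by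
        push_cast
        have hn : (0 : ℝ) ≤ n := n.cast_nonneg
        have : (1 + a / (n + 2)) * (1 - a ^ 2 / ((n + 2 : ℝ) + 1) ^ 2) -
            (1 + a / ((n + 1 : ℝ) + 2)) =
            (n + 3 + a) * (a * (1 - a)) / ((n + 2) * (n + 3) ^ 2) := by
          field_simp
          ring
        have h2 : 0 ≤ (n + 3 + a) * (a * (1 - a)) / ((n + 2) * (n + 3) ^ 2) := by
          have : 0 ≤ 1 - a := by linarith
          positivity
        linarith
      nlinarith [mul_le_mul_of_nonneg_left hstep hc]
  have hlim : (1 - a) * ((1 - a ^ 2 / 4) * (1 + a) / (1 + a / 2)) ≤ growthLimit β 2 := by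
    refine ge_of_tendsto' ((tendsto_growthRatio hβ 2).comp (tendsto_add_atTop_nat 2)) fun n => ?_
    refine le_trans ?_ (hbound n)
    have h1 : 0 ≤ 1 - a ^ 2 / 4 := by nlinarith
    have h2 : 0 ≤ 1 - a := by linarith
    have h3 : (1 - a) ≤ (1 - a) * (1 + a / (n + 2)) :=
      le_mul_of_one_le_right h2 (le_add_of_nonneg_right (by positivity))
    exact mul_le_mul_of_nonneg_right h3 (by positivity)
  have heq : β / (1 + β) = 1 - a := by rw [ha]; field_simp; ring
  have hgt : 1 < (1 - a ^ 2 / 4) * (1 + a) / (1 + a / 2) := by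
    rw [lt_div_iff₀ (by positivity)]
    have : (1 - a ^ 2 / 4) * (1 + a) - 1 * (1 + a / 2) = a / 4 * (1 - a) * (2 + a) := by ring
    have h3 : 0 < a / 4 * (1 - a) * (2 + a) := by
      have : 0 < 1 - a := by linarith
      positivity
    linarith
  rw [heq]
  refine lt_of_lt_of_le ?_ hlim
  have : 0 < 1 - a := by linarith
  nlinarith

/-- The mean growth of order `1` is of the order of magnitude `n ^ (1 / (1 + β))`: up to the choice
of the argument, it is the sequence in Gauss's product formula for the Gamma function. -/
theorem tendsto_growth_one_div_rpow (hβ : 0 < β) :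
    Tendsto (fun n : ℕ => growth β 1 n / ((n + 1 : ℕ) : ℝ) ^ (1 / (1 + β))) atTop
      (𝓝 (Real.Gamma (1 - 1 / (1 + β)))) := by
  set a := 1 / (1 + β) with ha
  have ha0 : 0 < a := by positivity
  have ha1 : a < 1 := by rw [ha, div_lt_one (by positivity)]; linarith
  rw [← tendsto_add_atTop_iff_nat 1]
  have hgrowth (n : ℕ) : growth β 1 n = n.factorial / ∏ j ∈ Finset.range n, (1 - a + j) := by
    rw [growth, ← Finset.prod_range_add_one_eq_factorial, Nat.cast_prod, ← Finset.prod_div_distrib]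
    refine Finset.prod_congr rfl fun k _ => ?_
    have hw := stepWeight_pos hβ k
    have h1 : 1 - a + k = stepWeight β k / (1 + β) := by
      rw [stepWeight, ha]; field_simp; ring
    have h2 : stepWeight β k + 1 = (k + 1) * (1 + β) := by rw [stepWeight]; ring
    rw [h1, Nat.cast_one, one_add_div hw.ne', h2]
    push_cast
    field_simp
  have h1 : Tendsto (fun n : ℕ => ((n + 1 : ℕ) : ℝ) / n) atTop (𝓝 1) := by
    have := tendsto_natCast_div_add_atTop (1 : ℝ)
    have h2 := this.inv₀ one_ne_zero
    rw [inv_one] at h2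
    refine h2.congr fun n => ?_
    rw [inv_div]; push_cast; rfl
  have h2 : Tendsto (fun n : ℕ => ((n : ℝ) / (n + 2 : ℕ)) ^ a) atTop (𝓝 1) := by
    have := (tendsto_natCast_div_add_atTop (2 : ℝ)).rpow_const (p := a) (Or.inl one_ne_zero)
    rw [Real.one_rpow] at this
    refine this.congr fun n => ?_
    push_cast; rfl
  have h3 := ((Real.GammaSeq_tendsto_Gamma (1 - a)).mul h1).mul h2
  rw [mul_one, mul_one] at h3
  refine h3.congr' ?_
  filter_upwards [eventually_gt_atTop 0] with n hn
  have hn' : (0 : ℝ) < n := by exact_mod_cast hn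
  have hprod : ∏ j ∈ Finset.range (n + 1), (1 - a + j) ≠ 0 :=
    Finset.prod_ne_zero_iff.2 fun j _ => by
      have : (0 : ℝ) ≤ j := j.cast_nonneg
      linarith
  have hpa : (0 : ℝ) < (n : ℝ) ^ a := by positivity
  have hpb : (0 : ℝ) < ((n + 2 : ℕ) : ℝ) ^ a := by positivity
  rw [hgrowth, Real.GammaSeq, Real.rpow_sub hn', Real.rpow_one,
    Real.div_rpow hn'.le (Nat.cast_nonneg _), Nat.factorial_succ, Nat.cast_mul]
  field_simp

theorem Gamma_one_sub_pos (hβ : 0 < β) : 0 < Real.Gamma (1 - 1 / (1 + β)) := by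
  refine Real.Gamma_pos_of_pos (sub_pos.2 ?_)
  rw [div_lt_one (by positivity)]
  linarith

theorem tendsto_rpow_exponent_atTop (hβ : 0 < β) :
    Tendsto (fun n : ℕ => ((n + 1 : ℕ) : ℝ) ^ (1 / (1 + β))) atTop atTop :=
  (tendsto_rpow_atTop (by positivity)).comp
    (tendsto_natCast_atTop_atTop.comp (tendsto_add_atTop_nat 1))

theorem tendsto_growth_atTop (hβ : 0 < β) {r : ℕ} (hr : 1 ≤ r) :
    Tendsto (growth β r) atTop atTop := by
  have h1 : Tendsto (growth β 1) atTop atTop := by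
    refine ((tendsto_growth_one_div_rpow hβ).pos_mul_atTop (Gamma_one_sub_pos hβ)
      (tendsto_rpow_exponent_atTop hβ)).congr fun n => ?_
    exact div_mul_cancel₀ _ (by positivity)
  refine tendsto_atTop_mono (fun n => ?_) h1
  refine Finset.prod_le_prod (fun k _ => zero_le_one.trans (one_le_growth_factor hβ 1 k))
    fun k _ => ?_
  have := stepWeight_pos hβ k
  gcongr

/-! ### Mean values of the rising factorials -/

/-- The limit of the discounted probability of birth of `x`, for `r ≥ 1`. It is also the `r`-th
moment of the product of the beta variables that belong to `x`. -/
noncomputable def birthFactor (β : ℝ) (r : ℕ) (x : Label) : ℝ :=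
  (x.map fun j : ℕ+ => ∏ i ∈ Finset.range j, (β + i) / (β + i + r)).prod

variable {Ω : Type*} [MeasurableSpace Ω] {P : Measure Ω} {G : ℕ → Ω → Finset Label}

/-- The probability that `x` is a vertex of `G (n + 1)`. -/
noncomputable def bornProb (P : Measure Ω) (β : ℝ) (G : ℕ → Ω → Finset Label) (x : Label)
    (n : ℕ) : ℝ :=
  ∫ ω, risingWeight β 0 x (G (n + 1) ω) ∂P

/-- The mean of `1 / growth β r n` at the time `n` of birth of `x`, restricted to births up to
time `N`. -/
noncomputable def discountedBirth (P : Measure Ω) (β : ℝ) (G : ℕ → Ω → Finset Label) (r : ℕ)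
    (x : Label) (N : ℕ) : ℝ :=
  bornProb P β G x 0 +
    ∑ n ∈ Finset.range N, (bornProb P β G x (n + 1) - bornProb P β G x n) / growth β r (n + 1)

namespace IsGeneralizedPORT

variable [IsProbabilityMeasure P]

/-- After the birth of `x`, the rising factorials of its weight are multiplied by `1 + r / w` in the
mean; the birth contributes the value at out-degree `0`. -/
theorem setIntegral_risingWeight_succ (hβ : 0 < β) (hG : IsGeneralizedPORT P β G) (r : ℕ)
    (x : Label) (n : ℕ) {s : Set Ω} (hs : MeasurableSet[hG.filtration n] s) :
    ∫ ω in s, risingWeight β r x (G (n + 2) ω) ∂P =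
      (1 + r / stepWeight β n) * ∫ ω in s, risingWeight β r x (G (n + 1) ω) ∂P +
      (ascPochhammer ℝ r).eval β * (∫ ω in s, risingWeight β 0 x (G (n + 2) ω) ∂P -
        ∫ ω in s, risingWeight β 0 x (G (n + 1) ω) ∂P) := by
  let φ : Finset Label → ℝ := fun T => (ascPochhammer ℝ r).eval (outDegree x T + β + 1) -
        (ascPochhammer ℝ r).eval (outDegree x T + β)
  have hI (r n : ℕ) : IntegrableOn (fun ω => risingWeight β r x (G (n + 1) ω)) s P :=
    (hG.integrable_comp hβ _ n).integrableOn
  have hφ : IntegrableOn ((chosen G x n).indicator fun ω => φ (G (n + 1) ω)) s P :=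
    ((hG.integrable_comp hβ _ n).indicator (hG.measurableSet_chosen x n)).integrableOn
  have hstep : ∀ᵐ ω ∂P, risingWeight β r x (G (n + 2) ω) = risingWeight β r x (G (n + 1) ω) +
      (chosen G x n).indicator (fun ω => φ (G (n + 1) ω)) ω + (ascPochhammer ℝ r).eval β *
        (risingWeight β 0 x (G (n + 2) ω) - risingWeight β 0 x (G (n + 1) ω)) := by
    classical
    filter_upwards [hG.ae_exists_mem_chosen hβ] with ω hω
    obtain ⟨v, hv, hv'⟩ := hω n
    have hT := hG.isTree (n + 1) (by omega) ω
    have hx : ω ∈ chosen G x n ↔ x = v := by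
      refine ⟨fun h => addChild_injective hT (h.2.symm.trans hv'), ?_⟩
      rintro rfl
      exact ⟨hv, hv'⟩
    rw [hv', risingWeight_addChild hT β r x hv, Set.indicator_apply]
    simp only [hx, φ]
  have hmid : ∫ ω in s, (chosen G x n).indicator (fun ω => φ (G (n + 1) ω)) ω ∂P =
      r / stepWeight β n * ∫ ω in s, risingWeight β r x (G (n + 1) ω) ∂P := by
    rw [hG.setIntegral_indicator_chosen hβ φ x n hs, ← integral_const_mul]
    refine integral_congr_ae (ae_of_all _ fun ω => ?_)
    dsimp only [φ]
    rw [risingWeight, risingWeight]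
    split_ifs
    · rw [ascPochhammer_one, Polynomial.eval_X, ascPochhammer_eval_add_one_mul]
      ring
    · simp
  have hadd : IntegrableOn (fun ω => risingWeight β r x (G (n + 1) ω) +
      (chosen G x n).indicator (fun ω => φ (G (n + 1) ω)) ω) s P := (hI r n).add hφ
  have hsub : IntegrableOn (fun ω => (ascPochhammer ℝ r).eval β *
      (risingWeight β 0 x (G (n + 2) ω) - risingWeight β 0 x (G (n + 1) ω))) s P :=
    ((hI 0 (n + 1)).sub (hI 0 n)).const_mul _
  rw [integral_congr_ae (ae_restrict_of_ae hstep), integral_add hadd hsub,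
    integral_add (hI r n) hφ, hmid,
    integral_const_mul, integral_sub (hI 0 (n + 1)) (hI 0 n)]
  ring

/-- The solution of the recursion for the mean of the rising factorials: a birth at time `n`
contributes the growth from time `n` on. -/
theorem integral_risingWeight (hβ : 0 < β) (hG : IsGeneralizedPORT P β G) (r : ℕ) (x : Label)
    (N : ℕ) : ∫ ω, risingWeight β r x (G (N + 1) ω) ∂P =
      (ascPochhammer ℝ r).eval β * discountedBirth P β G r x N * growth β r N := by
  induction N with
  | zero =>
    classical
    simp only [discountedBirth, bornProb, growth, Finset.range_zero, Finset.sum_empty, add_zero,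
      Finset.prod_empty, mul_one]
    rw [← integral_const_mul]
    refine integral_congr_ae (ae_of_all _ fun ω => ?_)
    dsimp only
    rw [zero_add, hG.initial, risingWeight, risingWeight]
    split_ifs with h
    · have : outDegree x {[]} = 0 := by
        rw [Finset.mem_singleton.1 h, outDegree, Finset.card_eq_zero, Finset.filter_eq_empty_iff]
        rintro u hu ⟨j, hj⟩
        rw [Finset.mem_singleton.1 hu] at hj
        simp at hj
      simp [this]
    · simp
  | succ N ih =>
    have h := hG.setIntegral_risingWeight_succ hβ r x N MeasurableSet.univ
    simp only [Measure.restrict_univ] at h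
    have hg := growth_pos hβ r (N + 1)
    have hs : discountedBirth P β G r x (N + 1) = discountedBirth P β G r x N +
        (bornProb P β G x (N + 1) - bornProb P β G x N) / growth β r (N + 1) := by
      rw [discountedBirth, discountedBirth, Finset.sum_range_succ, add_assoc]
    rw [h, ih, hs, mul_assoc _ (_ + _), add_mul (discountedBirth _ _ _ _ _ _),
      div_mul_cancel₀ _ hg.ne', growth_succ, bornProb, bornProb]
    ring

/-- The `(j + 1)`-st child of `y` is born when `y`, having `j` children, reproduces. The probability
that `y` has exactly `j` children is the difference on the right-hand side. -/
theorem bornProb_sub_bornProb (hβ : 0 < β) (hG : IsGeneralizedPORT P β G) (y : Label) (j n : ℕ) :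
    (bornProb P β G (child y (j + 1)) (n + 1) - bornProb P β G (child y (j + 1)) n) *
        stepWeight β n =
      (j + β) * (bornProb P β G (child y j) n - bornProb P β G (child y (j + 1)) n) := by
  classical
  have hw := stepWeight_pos hβ n
  let φ : Finset Label → ℝ := fun T => if outDegree y T = j then 1 else 0
  have hI (x : Label) (n : ℕ) : Integrable (fun ω => risingWeight β 0 x (G (n + 1) ω)) P :=
    hG.integrable_comp hβ _ n
  have hstep : ∀ᵐ ω ∂P, risingWeight β 0 (child y (j + 1)) (G (n + 2) ω) -
      risingWeight β 0 (child y (j + 1)) (G (n + 1) ω) =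
      (chosen G y n).indicator (fun ω => φ (G (n + 1) ω)) ω := by
    filter_upwards [hG.ae_exists_mem_chosen hβ] with ω hω
    obtain ⟨v, hv, hv'⟩ := hω n
    have hT := hG.isTree (n + 1) (by omega) ω
    have hx : ω ∈ chosen G y n ↔ y = v := by
      refine ⟨fun h => addChild_injective hT (h.2.symm.trans hv'), ?_⟩
      rintro rfl
      exact ⟨hv, hv'⟩
    rw [hv', risingWeight_zero, risingWeight_zero, Set.indicator_apply]
    simp only [hx, child_succ_mem_addChild_iff, child_mem_iff hT y (j + 1), φ]
    by_cases h1 : y = v <;> by_cases h2 : outDegree y (G (n + 1) ω) = j <;> simp_all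
  have h := hG.setIntegral_indicator_chosen hβ φ y n MeasurableSet.univ
  simp only [Measure.restrict_univ] at h
  rw [bornProb, bornProb, bornProb, ← integral_sub (hI _ (n + 1)) (hI _ n),
    integral_congr_ae hstep, h, ← integral_sub (hI _ n) (hI _ n), ← integral_const_mul,
    integral_div, div_mul_cancel₀ _ hw.ne']
  refine integral_congr_ae (ae_of_all _ fun ω => ?_)
  have hT := hG.isTree (n + 1) (by omega) ω
  dsimp only [φ]
  rw [risingWeight_zero, risingWeight_zero, risingWeight]
  simp only [child_mem_iff hT, ascPochhammer_one, Polynomial.eval_X]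
  by_cases hy : y ∈ G (n + 1) ω
  · rcases lt_trichotomy (outDegree y (G (n + 1) ω)) j with h | h | h
    · simp [hy, h.ne, h.not_ge, show ¬ j + 1 ≤ outDegree y (G (n + 1) ω) by omega]
    · simp [hy, h]
    · simp [hy, h.ne', h.le, show j + 1 ≤ outDegree y (G (n + 1) ω) by omega]
  · simp [hy]

theorem bornProb_mem_Icc (hβ : 0 < β) (hG : IsGeneralizedPORT P β G) (x : Label) (n : ℕ) :
    bornProb P β G x n ∈ Set.Icc 0 1 := by
  classical
  refine ⟨integral_nonneg fun ω => risingWeight_nonneg hβ 0 x _, ?_⟩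
  calc bornProb P β G x n ≤ ∫ _, (1 : ℝ) ∂P := by
        refine integral_mono (hG.integrable_comp hβ _ n) (integrable_const _) fun ω => ?_
        dsimp only
        rw [risingWeight_zero]
        split_ifs <;> norm_num
    _ = 1 := by simp

/-- Summation by parts turns the recursion for the probabilities of birth into a relation between
the discounted probabilities of birth of consecutive siblings. -/
theorem discountedBirth_child_succ (hβ : 0 < β) (hG : IsGeneralizedPORT P β G) (r : ℕ) (y : Label)
    (j N : ℕ) : discountedBirth P β G r (child y (j + 1)) N =
      (β + j) / (β + j + r) * (discountedBirth P β G r (child y j) N -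
        (bornProb P β G (child y j) N - bornProb P β G (child y (j + 1)) N) / growth β r N) := by
  induction N with
  | zero =>
    have h0 : bornProb P β G (child y (j + 1)) 0 = 0 := by
      simp [bornProb, hG.initial, risingWeight, child]
    simp [discountedBirth, h0, growth]
  | succ N ih =>
    have hrec := hG.bornProb_sub_bornProb hβ y j N
    have hw := stepWeight_pos hβ N
    have hg := growth_pos hβ r N
    have hs : discountedBirth P β G r (child y (j + 1)) (N + 1) = discountedBirth P β G r
        (child y (j + 1)) N + (bornProb P β G (child y (j + 1)) (N + 1) -
          bornProb P β G (child y (j + 1)) N) / growth β r (N + 1) := by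
      rw [discountedBirth, discountedBirth, Finset.sum_range_succ, add_assoc]
    have hs' : discountedBirth P β G r (child y j) (N + 1) = discountedBirth P β G r
        (child y j) N + (bornProb P β G (child y j) (N + 1) -
          bornProb P β G (child y j) N) / growth β r (N + 1) := by
      rw [discountedBirth, discountedBirth, Finset.sum_range_succ, add_assoc]
    rw [hs, hs', ih, growth_succ]
    have hwr : 0 < stepWeight β N + r := by positivity
    have hbj : 0 < β + j + r := by positivity
    field_simp
    linear_combination r * hrec

/-- Passing from one sibling to the next multiplies the limit by `(β + j) / (β + j + r)`, since the
boundary term in `discountedBirth_child_succ` tends to zero. -/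
theorem tendsto_discountedBirth (hβ : 0 < β) (hG : IsGeneralizedPORT P β G) {r : ℕ} (hr : 1 ≤ r)
    (x : Label) : Tendsto (discountedBirth P β G r x) atTop (𝓝 (birthFactor β r x)) := by
  induction x using List.reverseRecOn with
  | nil =>
    have hb (n : ℕ) : bornProb P β G [] n = 1 := by
      have (ω : Ω) : [] ∈ G (n + 1) ω := (hG.isTree _ (by omega) ω).1
      simp [bornProb, risingWeight, this]
    refine tendsto_const_nhds.congr fun N => ?_
    simp [discountedBirth, birthFactor, hb]
  | append_singleton y j ih =>
    have hchild (j : ℕ) : Tendsto (discountedBirth P β G r (child y j)) atTop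
        (𝓝 (birthFactor β r y * ∏ i ∈ Finset.range j, (β + i) / (β + i + r))) := by
      induction j with
      | zero => simpa [child] using ih
      | succ j ihj =>
        have hz : Tendsto (fun N => (bornProb P β G (child y j) N -
            bornProb P β G (child y (j + 1)) N) / growth β r N) atTop (𝓝 0) := by
          refine squeeze_zero_norm (fun N => ?_) (tendsto_growth_atTop hβ hr).inv_tendsto_atTop
          have h1 := hG.bornProb_mem_Icc hβ (child y j) N
          have h2 := hG.bornProb_mem_Icc hβ (child y (j + 1)) N
          have hg := growth_pos hβ r N
          rw [norm_div, Real.norm_of_nonneg hg.le, Pi.inv_apply, ← one_div]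
          gcongr
          rw [Real.norm_eq_abs, abs_le]
          constructor <;> linarith [h1.1, h1.2, h2.1, h2.2]
        have := (ihj.sub hz).const_mul ((β + j) / (β + j + r))
        rw [sub_zero, mul_comm, mul_assoc, ← Finset.prod_range_succ] at this
        exact this.congr fun N => (hG.discountedBirth_child_succ hβ r y j N).symm
    rw [← child_coe]
    simpa [birthFactor, child_coe] using hchild j

end IsGeneralizedPORT

end

section

/-! ### Rising factorials and bounds for the moments -/

variable {β : ℝ}

theorem ascPochhammer_eval_mono_add (r n : ℕ) {y : ℝ} (hy : 0 < y) :
    (ascPochhammer ℝ r).eval y ≤ (ascPochhammer ℝ r).eval (y + n) := by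
  induction r with
  | zero => simp
  | succ r ih =>
    rw [ascPochhammer_succ_eval, ascPochhammer_succ_eval]
    have h1 := ascPochhammer_pos r (y + n) (by positivity)
    have : (0 : ℝ) ≤ n := n.cast_nonneg
    exact mul_le_mul ih (by linarith) (by positivity) h1.le

theorem ascPochhammer_eval_sq_le (r : ℕ) {y : ℝ} (hy : 0 < y) :
    (ascPochhammer ℝ r).eval y ^ 2 ≤ (ascPochhammer ℝ (2 * r)).eval y := by
  have h : (ascPochhammer ℝ (2 * r)).eval y =
      (ascPochhammer ℝ r).eval y * (ascPochhammer ℝ r).eval (y + r) := by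
    rw [two_mul, ← ascPochhammer_mul]
    simp
  rw [h, sq]
  exact mul_le_mul_of_nonneg_left (ascPochhammer_eval_mono_add r r hy) (ascPochhammer_pos r y hy).le

theorem ascPochhammer_eval_le_pow_mul_factorial (r : ℕ) {y : ℝ} (hy : 0 < y) :
    (ascPochhammer ℝ r).eval y ≤ (1 + y) ^ r * r.factorial := by
  induction r with
  | zero => simp
  | succ r ih =>
    rw [ascPochhammer_succ_eval, Nat.factorial_succ, pow_succ, Nat.cast_mul]
    have hr : (0 : ℝ) ≤ r := r.cast_nonneg
    calc _ ≤ ((1 + y) ^ r * r.factorial) * ((1 + y) * (r + 1 : ℕ)) := by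
          refine mul_le_mul ih ?_ (by positivity) (by positivity)
          push_cast
          nlinarith
      _ = _ := by ring

theorem birthFactor_pos (hβ : 0 < β) (r : ℕ) (x : Label) : 0 < birthFactor β r x := by
  refine List.prod_pos fun a ha => ?_
  obtain ⟨j, -, rfl⟩ := List.mem_map.1 ha
  exact Finset.prod_pos fun i _ => by positivity

theorem birthFactor_le_one (hβ : 0 < β) (r : ℕ) (x : Label) : birthFactor β r x ≤ 1 := by
  induction x with
  | nil => simp [birthFactor]
  | cons j x ih =>
    rw [birthFactor, List.map_cons, List.prod_cons, ← birthFactor]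
    refine mul_le_one₀ (Finset.prod_le_one (fun i _ => by positivity) fun i _ => ?_)
      (birthFactor_pos hβ r x).le ih
    rw [div_le_one (by positivity)]
    exact le_add_of_nonneg_right r.cast_nonneg

/-- This is Jensen's inequality for the product of beta variables that belongs to `x`. -/
theorem birthFactor_one_sq_le (hβ : 0 < β) (x : Label) :
    birthFactor β 1 x ^ 2 ≤ birthFactor β 2 x := by
  induction x with
  | nil => simp [birthFactor]
  | cons j x ih =>
    rw [birthFactor, birthFactor, List.map_cons, List.prod_cons, List.map_cons, List.prod_cons,
      ← birthFactor, ← birthFactor, mul_pow, ← Finset.prod_pow]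
    refine mul_le_mul (Finset.prod_le_prod (fun i _ => by positivity) fun i _ => ?_) ih
      (by positivity) (Finset.prod_nonneg fun i _ => by positivity)
    rw [div_pow, div_le_div_iff₀ (by positivity) (by positivity)]
    have : 0 < β + i := by positivity
    push_cast
    nlinarith

/-- Rising factorials of the weight may replace its powers in the limit. -/
theorem tendsto_risingWeight_div_pow (hβ : 0 < β) {x : Label} {t : ℕ → Finset Label}
    {z : ℝ}
    (h : Tendsto (fun n => risingWeight β 1 x (t n) / growth β 1 n) atTop (𝓝 z))
    {r : ℕ} (hr : 1 ≤ r) :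
    Tendsto (fun n => risingWeight β r x (t n) / growth β 1 n ^ r) atTop (𝓝 (z ^ r)) := by
  classical
  induction r, hr using Nat.le_induction with
  | base => simpa using h
  | succ r hr ih =>
    have hz : Tendsto (fun n => r * risingWeight β 0 x (t n) / growth β 1 n) atTop
        (𝓝 0) := by
      have h0 := (tendsto_growth_atTop hβ le_rfl).inv_tendsto_atTop.const_mul (r : ℝ)
      rw [mul_zero] at h0
      refine squeeze_zero (fun n => ?_) (fun n => ?_) h0
      · exact div_nonneg (mul_nonneg r.cast_nonneg (risingWeight_nonneg hβ _ _ _))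
          (growth_pos hβ 1 n).le
      · have := growth_pos hβ 1 n
        rw [risingWeight_zero, Pi.inv_apply, ← div_eq_mul_inv]
        gcongr
        refine mul_le_of_le_one_right r.cast_nonneg ?_
        split_ifs <;> norm_num
    have hmul := ih.mul (h.add hz)
    rw [add_zero, ← pow_succ] at hmul
    refine hmul.congr fun n => ?_
    have hg := growth_pos hβ 1 n
    simp only [risingWeight]
    split_ifs
    · simp only [ascPochhammer_one, Polynomial.eval_X, ascPochhammer_zero, Polynomial.eval_one,
        ascPochhammer_succ_eval]
      field_simp
      ring
    · simp

variable {Ω : Type*} [MeasurableSpace Ω] {P : Measure Ω} {G : ℕ → Ω → Finset Label}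

namespace IsGeneralizedPORT

variable [IsProbabilityMeasure P]

/-! ### Almost sure convergence and moments of the limit -/

/-- The normalized weight is a martingale after the birth of `x`, and the birth lets it jump up. -/
theorem submartingale_normalized_weight (hβ : 0 < β) (hG : IsGeneralizedPORT P β G) (x : Label) :
    Submartingale (fun n ω => risingWeight β 1 x (G (n + 1) ω) / growth β 1 n) hG.filtration P := by
  refine submartingale_of_setIntegral_le_succ
    (fun n => (hG.measurable_filtration (fun T => risingWeight β 1 x T / growth β 1 n)
      n).stronglyMeasurable)
    (fun n => hG.integrable_comp hβ (fun T => risingWeight β 1 x T / growth β 1 n) n)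
    fun n s hs => ?_
  have hI (n : ℕ) : IntegrableOn (fun ω => risingWeight β 0 x (G (n + 1) ω)) s P :=
    (hG.integrable_comp hβ _ n).integrableOn
  have hborn : ∫ ω in s, risingWeight β 0 x (G (n + 1) ω) ∂P ≤
      ∫ ω in s, risingWeight β 0 x (G (n + 2) ω) ∂P := by
    classical
    refine integral_mono_ae (hI n) (hI (n + 1)) (ae_restrict_of_ae ?_)
    filter_upwards [hG.ae_exists_mem_chosen hβ] with ω hω
    obtain ⟨v, hv, hv'⟩ := hω n
    have hsub : x ∈ G (n + 1) ω → x ∈ G (n + 2) ω := fun h =>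
      hv' ▸ Finset.mem_insert_of_mem h
    rw [risingWeight_zero, risingWeight_zero]
    by_cases h : x ∈ G (n + 1) ω
    · simp [h, hsub h]
    · rw [if_neg h]
      split_ifs <;> norm_num
  have hfac := zero_lt_one.trans_le (one_le_growth_factor hβ 1 n)
  rw [integral_div, integral_div, hG.setIntegral_risingWeight_succ hβ 1 x n hs, growth_succ,
    div_le_div_iff₀ (growth_pos hβ 1 n) (mul_pos (growth_pos hβ 1 n) hfac), ascPochhammer_one,
    Polynomial.eval_X]
  nlinarith [mul_nonneg (mul_nonneg hβ.le (sub_nonneg.2 hborn)) (growth_pos hβ 1 n).le]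

theorem exists_discountedBirth_le (hβ : 0 < β) (hG : IsGeneralizedPORT P β G) {r : ℕ} (hr : 1 ≤ r)
    (x : Label) : ∃ C : ℝ, 0 ≤ C ∧ ∀ N, discountedBirth P β G r x N ≤ C := by
  obtain ⟨C, hC⟩ := (hG.tendsto_discountedBirth hβ hr x).bddAbove_range
  exact ⟨max C 0, le_max_right _ _, fun N => (hC ⟨N, rfl⟩).trans (le_max_left _ _)⟩

/-- The limit comes from the convergence theorem for submartingales that are bounded in mean. -/
theorem exists_tendsto_normalized_weight (hβ : 0 < β) (hG : IsGeneralizedPORT P β G) (x : Label) :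
    ∃ Z : Ω → ℝ, Measurable Z ∧ ∀ᵐ ω ∂P,
      Tendsto (fun n => risingWeight β 1 x (G (n + 1) ω) / growth β 1 n) atTop (𝓝 (Z ω)) := by
  obtain ⟨C, hC0, hC⟩ := hG.exists_discountedBirth_le hβ le_rfl x
  have hbdd (n : ℕ) : eLpNorm (fun ω => risingWeight β 1 x (G (n + 1) ω) / growth β 1 n) 1 P ≤
      ((β * C).toNNReal : NNReal) := by
    have hnn (ω : Ω) : 0 ≤ risingWeight β 1 x (G (n + 1) ω) / growth β 1 n :=
      div_nonneg (risingWeight_nonneg hβ _ _ _) (growth_pos hβ 1 n).le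
    rw [eLpNorm_one_eq_lintegral_enorm]
    simp only [Real.enorm_of_nonneg (hnn _)]
    rw [← ofReal_integral_eq_lintegral_ofReal
      (hG.integrable_comp hβ (fun T => risingWeight β 1 x T / growth β 1 n) n) (ae_of_all _ hnn)]
    refine ENNReal.ofReal_le_ofReal ?_
    rw [integral_div, hG.integral_risingWeight hβ, mul_div_cancel_right₀ _ (growth_pos hβ 1 n).ne',
      ascPochhammer_one, Polynomial.eval_X]
    exact mul_le_mul_of_nonneg_left (hC n) hβ.le
  exact measurable_limit_of_tendsto_metrizable_ae (fun n => (hG.measurable_comp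
      (fun T => risingWeight β 1 x T / growth β 1 n) n).aemeasurable)
      ((hG.submartingale_normalized_weight hβ x).exists_ae_tendsto_of_bdd hbdd)

/-- The means of the normalized rising factorials of order `r` converge to the `r`-th moment of the
limit, since those of order `2 * r` bound their second moments. -/
theorem moments_limit (hβ : 0 < β) (hG : IsGeneralizedPORT P β G) {x : Label} {Z : Ω → ℝ}
    (hZ : Measurable Z) (hlim : ∀ᵐ ω ∂P,
      Tendsto (fun n => risingWeight β 1 x (G (n + 1) ω) / growth β 1 n) atTop (𝓝 (Z ω)))
    {r : ℕ} (hr : 1 ≤ r) : Integrable (fun ω => Z ω ^ r) P ∧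
      ∫ ω, Z ω ^ r ∂P =
        (ascPochhammer ℝ r).eval β * birthFactor β r x * growthLimit β r := by
  obtain ⟨C, hC0, hC⟩ := hG.exists_discountedBirth_le hβ (r := 2 * r) (by omega) x
  have hmean (s t n : ℕ) : ∫ ω, risingWeight β s x (G (n + 1) ω) / growth β 1 n ^ t ∂P =
      (ascPochhammer ℝ s).eval β * discountedBirth P β G s x n *
        (growth β s n / growth β 1 n ^ t) := by
    rw [integral_div, hG.integral_risingWeight hβ, mul_div_assoc]
  have hsq (n : ℕ) : ∫ ω, (risingWeight β r x (G (n + 1) ω) / growth β 1 n ^ r) ^ 2 ∂P ≤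
      (ascPochhammer ℝ (2 * r)).eval β * C := by
    have hg := growth_pos hβ 1 n
    have hP := ascPochhammer_pos (2 * r) β hβ
    calc _ ≤ ∫ ω, risingWeight β (2 * r) x (G (n + 1) ω) / growth β 1 n ^ (2 * r) ∂P := by
          refine integral_mono
            (hG.integrable_comp hβ (fun T => (risingWeight β r x T / growth β 1 n ^ r) ^ 2) n)
            (hG.integrable_comp hβ
              (fun T => risingWeight β (2 * r) x T / growth β 1 n ^ (2 * r)) n) fun ω => ?_
          dsimp only
          rw [div_pow, ← pow_mul, mul_comm r 2]
          gcongr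
          rw [risingWeight, risingWeight]
          split_ifs
          · exact ascPochhammer_eval_sq_le r (by positivity)
          · simp
      _ = (ascPochhammer ℝ (2 * r)).eval β * discountedBirth P β G (2 * r) x n *
            growthRatio β (2 * r) n := hmean _ _ n
      _ ≤ (ascPochhammer ℝ (2 * r)).eval β * C * 1 :=
          mul_le_mul (mul_le_mul_of_nonneg_left (hC n) hP.le) (growthRatio_le_one hβ _ n)
            (growthRatio_nonneg hβ _ n) (by positivity)
      _ = _ := mul_one _
  obtain ⟨h1, h2⟩ := integral_tendsto_of_ae_tendsto_of_sq_bounded (μ := P)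
    (f := fun n ω => risingWeight β r x (G (n + 1) ω) / growth β 1 n ^ r) (g := fun ω => Z ω ^ r)
    (C := (ascPochhammer ℝ (2 * r)).eval β * C)
    (fun n => hG.measurable_comp (fun T => risingWeight β r x T / growth β 1 n ^ r) n)
    (fun n => ae_of_all _ fun ω => div_nonneg (risingWeight_nonneg hβ _ _ _)
      (pow_nonneg (growth_pos hβ 1 n).le _))
    (fun n => hG.integrable_comp hβ (fun T => (risingWeight β r x T / growth β 1 n ^ r) ^ 2) n)
    hsq (by filter_upwards [hlim] with ω hω using
      tendsto_risingWeight_div_pow hβ (t := fun n => G (n + 1) ω) hω hr)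
    (hZ.pow_const r)
  refine ⟨h1, tendsto_nhds_unique h2 ?_⟩
  simp only [hmean]
  exact ((hG.tendsto_discountedBirth hβ hr x).const_mul _).mul (tendsto_growthRatio hβ r)

/-- The scaled degree of every vertex converges almost surely, and the moments of the limit are
explicit. They depend on the vertex through `birthFactor` only. -/
theorem exists_degreeConverges (hβ : 0 < β) (hG : IsGeneralizedPORT P β G) (x : Label) :
    ∃ ζ : Ω → ℝ, Measurable ζ ∧ DegreeConverges P β G x ζ ∧ (∀ᵐ ω ∂P, 0 ≤ ζ ω) ∧
      ∀ r : ℕ, 1 ≤ r → Integrable (fun ω => ζ ω ^ r) P ∧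
        ∫ ω, ζ ω ^ r ∂P = Real.Gamma (1 - 1 / (1 + β)) ^ r *
          ((ascPochhammer ℝ r).eval β * growthLimit β r) * birthFactor β r x := by
  classical
  obtain ⟨Z, hZ, hlim⟩ := hG.exists_tendsto_normalized_weight hβ x
  have hκ := Gamma_one_sub_pos hβ
  refine ⟨fun ω => Real.Gamma (1 - 1 / (1 + β)) * Z ω, hZ.const_mul _, ?_, ?_, fun r hr => ?_⟩
  · rw [DegreeConverges]
    filter_upwards [hlim] with ω hω
    rw [← tendsto_add_atTop_iff_nat 1]
    have hdiff : Tendsto (fun n : ℕ => ((degree x (G (n + 1) ω) : ℝ) -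
        risingWeight β 1 x (G (n + 1) ω)) / ((n + 1 : ℕ) : ℝ) ^ (1 / (1 + β))) atTop (𝓝 0) := by
      have h0 := (tendsto_rpow_exponent_atTop hβ).inv_tendsto_atTop.const_mul (1 + β)
      rw [mul_zero] at h0
      refine squeeze_zero_norm (fun n => ?_) h0
      have hT := hG.isTree (n + 1) (by omega) ω
      have hp : (0 : ℝ) < ((n + 1 : ℕ) : ℝ) ^ (1 / (1 + β)) := by positivity
      rw [norm_div, Real.norm_of_nonneg hp.le, Pi.inv_apply, ← div_eq_mul_inv]
      gcongr
      have h1 : (outDegree x (G (n + 1) ω) : ℝ) ≤ degree x (G (n + 1) ω) := by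
        exact_mod_cast outDegree_le_degree hT x
      have h2 : (degree x (G (n + 1) ω) : ℝ) ≤ outDegree x (G (n + 1) ω) + 1 := by
        exact_mod_cast degree_le_outDegree_add_one x
      rw [risingWeight, Real.norm_eq_abs, abs_le]
      split_ifs with hx
      · rw [ascPochhammer_one, Polynomial.eval_X]
        constructor <;> linarith
      · rw [outDegree_eq_zero_of_notMem hT hx, Nat.cast_zero] at h1 h2
        constructor <;> linarith
    have hmain := ((tendsto_growth_one_div_rpow hβ).mul hω).add hdiff
    rw [add_zero] at hmain
    refine hmain.congr fun n => ?_
    have hg := growth_pos hβ 1 n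
    have hp : (0 : ℝ) < ((n + 1 : ℕ) : ℝ) ^ (1 / (1 + β)) := by positivity
    field_simp
    ring
  · filter_upwards [hlim] with ω hω
    exact mul_nonneg hκ.le (ge_of_tendsto' hω fun n =>
      div_nonneg (risingWeight_nonneg hβ _ _ _) (growth_pos hβ 1 n).le)
  · obtain ⟨h1, h2⟩ := hG.moments_limit hβ hZ hlim hr
    simp only [mul_pow]
    refine ⟨h1.const_mul _, ?_⟩
    rw [integral_const_mul, h2]
    ring

/-- The first two moments show that the variance of the limit does not vanish. -/
theorem nondegenerate_of_moments (hβ : 0 < β) {x : Label} {ζ : Ω → ℝ}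
    (hmom : ∀ r : ℕ, 1 ≤ r → ∫ ω, ζ ω ^ r ∂P = Real.Gamma (1 - 1 / (1 + β)) ^ r *
      ((ascPochhammer ℝ r).eval β * growthLimit β r) * birthFactor β r x) :
    Nondegenerate P ζ := by
  rintro ⟨c, hc⟩
  have hpow (r : ℕ) : ∫ ω, ζ ω ^ r ∂P = c ^ r := by
    rw [integral_congr_ae (g := fun _ => c ^ r) (by filter_upwards [hc] with ω hω using by rw [hω])]
    simp
  have h1 := hmom 1 le_rfl
  have h2 := hmom 2 one_le_two
  rw [hpow, pow_one, pow_one, growthLimit_one hβ, ascPochhammer_one, Polynomial.eval_X,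
    mul_one] at h1
  rw [hpow, h1, ascPochhammer_succ_eval, ascPochhammer_one, Polynomial.eval_X, Nat.cast_one] at h2
  have hκ := Gamma_one_sub_pos hβ
  have hL := lt_growthLimit_two hβ
  rw [div_lt_iff₀ (by positivity)] at hL
  have hB := birthFactor_one_sq_le hβ x
  have hB2 := birthFactor_pos hβ 2 x
  have h3 : β * birthFactor β 1 x ^ 2 = (β + 1) * growthLimit β 2 * birthFactor β 2 x := by
    have h4 : Real.Gamma (1 - 1 / (1 + β)) ^ 2 * β * (β * birthFactor β 1 x ^ 2) =
        Real.Gamma (1 - 1 / (1 + β)) ^ 2 * β *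
          ((β + 1) * growthLimit β 2 * birthFactor β 2 x) := by linear_combination h2
    exact mul_left_cancel₀ (by positivity) h4
  nlinarith [mul_lt_mul_of_pos_right hL hB2, mul_le_mul_of_nonneg_left hB hβ.le]

end IsGeneralizedPORT

/-! ### The law of the limit -/

theorem prod_moments_betaMeasure (hβ : 0 < β) (r : ℕ) {k : ℕ} (x : Fin k → ℕ+) :
    ∏ s, ∫ y, y ^ r ∂(betaMeasure β ((x s : ℕ) : ℝ)) = birthFactor β r (List.ofFn x) := by
  rw [birthFactor, List.map_ofFn, List.prod_ofFn]
  refine Finset.prod_congr rfl fun s _ => ?_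
  rw [(integral_pow_betaMeasure hβ (by exact_mod_cast (x s).pos) r).2,
    beta_add_div_beta hβ r (x s).pos]
  rfl

end

end FamilyTree

open FamilyTree in
theorem theorem2 {Ω : Type*} [MeasurableSpace Ω] (P : Measure Ω) [IsProbabilityMeasure P]
    (β : ℝ) (hβ : 0 < β) (G : ℕ → Ω → Finset FamilyTree.Label)
    (hG : FamilyTree.IsGeneralizedPORT P β G)
    (k : ℕ) (hk : 1 ≤ k) (x : Fin k → ℕ+) :
    ∃ ζ₀ ζₓ : Ω → ℝ,
      Measurable ζ₀ ∧ FamilyTree.DegreeConverges P β G [] ζ₀ ∧ FamilyTree.Nondegenerate P ζ₀ ∧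
      Measurable ζₓ ∧ FamilyTree.DegreeConverges P β G (List.ofFn x) ζₓ ∧
      FamilyTree.Nondegenerate P ζₓ ∧
      ∃ (Ω' : Type) (_ : MeasurableSpace Ω') (P' : Measure Ω') (_ : IsProbabilityMeasure P')
        (Z : Ω' → ℝ) (ξ : Fin k → Ω' → ℝ),
        iIndepFun (Fin.cons Z ξ : Fin (k + 1) → Ω' → ℝ) P' ∧
        IdentDistrib Z ζ₀ P' P ∧
        (∀ s : Fin k, HasLaw (ξ s) (betaMeasure β ((x s : ℕ) : ℝ)) P') ∧
        IdentDistrib ζₓ (fun ω => Z ω * ∏ s, ξ s ω) P P' := by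
  obtain ⟨ζ₀, hm₀, hc₀, hn₀, hmom₀⟩ := hG.exists_degreeConverges hβ []
  obtain ⟨ζₓ, hmₓ, hcₓ, hnₓ, hmomₓ⟩ := hG.exists_degreeConverges hβ (List.ofFn x)
  have hxpos (s : Fin k) : (0 : ℝ) < ((x s : ℕ) : ℝ) := by exact_mod_cast (x s).pos
  let μ : Fin (k + 1) → Measure ℝ := Fin.cons (P.map ζ₀) fun s => betaMeasure β ((x s : ℕ) : ℝ)
  have hμ (i : Fin (k + 1)) : IsProbabilityMeasure (μ i) := by
    refine Fin.cases ?_ (fun s => ?_) i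
    · exact Measure.isProbabilityMeasure_map hm₀.aemeasurable
    · exact isProbabilityMeasureBeta hβ (hxpos s)
  have hcoord (i : Fin (k + 1)) : HasLaw (fun ω : Fin (k + 1) → ℝ => ω i) (μ i) (Measure.pi μ) :=
    (measurePreserving_eval μ i).hasLaw
  have hμ0 (i : Fin (k + 1)) : ∀ᵐ y ∂(μ i), 0 ≤ y := by
    refine Fin.cases ?_ (fun s => ?_) i
    · exact (ae_map_iff hm₀.aemeasurable measurableSet_Ici).2 hn₀
    · exact betaMeasure_ae_nonneg _ _
  have hint₀ (r : ℕ) : Integrable (fun ω => ζ₀ ω ^ r) P := by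
    rcases Nat.eq_zero_or_pos r with rfl | hr
    · simp
    · exact (hmom₀ r hr).1
  have hintₓ (r : ℕ) : Integrable (fun ω => ζₓ ω ^ r) P := by
    rcases Nat.eq_zero_or_pos r with rfl | hr
    · simp
    · exact (hmomₓ r hr).1
  have hμi (r : ℕ) (i : Fin (k + 1)) : Integrable (fun y => y ^ r) (μ i) := by
    refine Fin.cases ?_ (fun s => ?_) i
    · exact (integrable_map_measure (measurable_id.pow_const r).aestronglyMeasurable
        hm₀.aemeasurable).2 (hint₀ r)
    · exact (integral_pow_betaMeasure hβ (hxpos s) r).1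
  have hpow (r : ℕ) (ω : Fin (k + 1) → ℝ) :
      (ω 0 * ∏ s : Fin k, ω s.succ) ^ r = ∏ i, (ω i) ^ r := by
    rw [Fin.prod_univ_succ, mul_pow, Finset.prod_pow]
  refine ⟨ζ₀, ζₓ, hm₀, hc₀,
    IsGeneralizedPORT.nondegenerate_of_moments hβ fun r hr => (hmom₀ r hr).2,
    hmₓ, hcₓ, IsGeneralizedPORT.nondegenerate_of_moments hβ fun r hr => (hmomₓ r hr).2,
    Fin (k + 1) → ℝ, inferInstance, Measure.pi μ, inferInstance, fun ω => ω 0,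
    fun s ω => ω s.succ, ?_, ?_, fun s => hcoord s.succ, ?_⟩
  -- The coordinates of a product space are independent.
  · have : (Fin.cons (fun ω => ω 0) fun s ω => ω s.succ :
        Fin (k + 1) → (Fin (k + 1) → ℝ) → ℝ) = fun i ω => ω i := by
      funext i
      refine Fin.cases rfl (fun s => rfl) i
    rw [this]
    exact iIndepFun_pi (X := fun _ y => y) fun i => aemeasurable_id
  · exact ⟨(hcoord 0).aemeasurable, hm₀.aemeasurable, (hcoord 0).map_eq⟩
  · refine identDistrib_of_moments_eq (C := 1)
      (K := Real.Gamma (1 - 1 / (1 + β)) * (1 + β)) hmₓ (by fun_prop) hnₓ ?_ hintₓ (fun r => ?_)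
      (fun r => ?_) zero_le_one (mul_pos (Gamma_one_sub_pos hβ) (by linarith)) fun r => ?_
    · have : ∀ᵐ ω ∂(Measure.pi μ), ∀ i, 0 ≤ ω i := ae_all_iff.2 fun i =>
        ((measurePreserving_eval μ i).quasiMeasurePreserving.ae (hμ0 i))
      filter_upwards [this] with ω hω
      exact mul_nonneg (hω 0) (Finset.prod_nonneg fun s _ => hω s.succ)
    · simp only [hpow]
      exact Integrable.fintype_prod_dep (hμi r)
    · simp only [hpow]
      rw [integral_fintype_prod_eq_prod (fun (_ : Fin (k + 1)) (y : ℝ) => y ^ r),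
        Fin.prod_univ_succ]
      have h0 : ∫ y, y ^ r ∂(μ 0) = ∫ ω, ζ₀ ω ^ r ∂P :=
        integral_map hm₀.aemeasurable (measurable_id.pow_const r).aestronglyMeasurable
      have hs : ∏ s : Fin k, ∫ y, y ^ r ∂(μ s.succ) = birthFactor β r (List.ofFn x) :=
        prod_moments_betaMeasure hβ r x
      rw [h0, hs]
      -- The moment formula for the limits is available for `r ≥ 1` only.
      rcases Nat.eq_zero_or_pos r with rfl | hr
      · have : birthFactor β 0 (List.ofFn x) = 1 := by
          rw [← prod_moments_betaMeasure hβ]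
          refine Finset.prod_eq_one fun s _ => ?_
          have := isProbabilityMeasureBeta hβ (hxpos s)
          simp
        simp [this]
      · rw [(hmomₓ r hr).2, (hmom₀ r hr).2]
        simp [birthFactor]
    · rcases Nat.eq_zero_or_pos r with rfl | hr
      · simp
      · rw [(hmomₓ r hr).2, one_mul, mul_pow, mul_assoc, mul_assoc _ ((1 + β) ^ r)]
        have hκ := Gamma_one_sub_pos hβ
        have hP := ascPochhammer_pos r β hβ
        refine mul_le_mul_of_nonneg_left ?_ (pow_nonneg hκ.le r)
        calc _ ≤ (ascPochhammer ℝ r).eval β * 1 * 1 :=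
              mul_le_mul (mul_le_mul_of_nonneg_left (growthLimit_le_one hβ r) hP.le)
                (birthFactor_le_one hβ r _) (birthFactor_pos hβ r _).le (by positivity)
          _ ≤ _ := by
            rw [mul_one, mul_one]
            exact ascPochhammer_eval_le_pow_mul_factorial r hβ
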